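/- Let $1\le p\le\infty$, let $\Omega\subseteq\mathbb{R}^N$ be open, $x\in\Omega$, and let $u\in C^2(\Omega)$ be real-valued with $\nabla u(x)\neq 0$. For every $\varepsilon>0$ with $\overline{B_\varepsilon(x)}\subset\Omega$ there is a unique real number $\mu_p(\varepsilon,u)(x)$ (the $p$-mean of $u$ in $\overline{B_\varepsilon(x)}$) such that $$\Vert u-\mu_p(\varepsilon,u)(x)\Vert_{L^p(\overline{B_\varepsilon(x)})}=\min_{\lambda\in\mathbb{R}}\Vert u-\lambda\Vert_{L^p(\overline{B_\varepsilon(x)})},$$ the norms being taken with respect to Lebesgue measure. Let $$\Delta_p^n u=\frac{\nabla\cdot(|\nabla u|^{p-2}\nabla u)}{|\nabla u|^{p-2}}\quad(1\le p<\infty),\qquad \Delta_\infty^n u=\frac{\langle\nabla^2u\,\nabla u,\nabla u\rangle}{|\nabla u|^2}$$ be the normalized $p$-Laplacian. Then, as $\varepsilon\to0^+$, $$\mu_p(\varepsilon,u)(x)=u(x)+\frac12\,\frac{\Delta_p^n u(x)}{N+p}\,\varepsilon^2+o(\varepsilon^2)\quad\text{if } 1\le p<\infty,$$ $$\mu_\infty(\varepsilon,u)(x)=u(x)+\frac12\,\Delta_\infty^n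 u(x)\,\varepsilon^2+o(\varepsilon^2)\quad\text{if } p=\infty.$$ -/

import Mathlib

open MeasureTheory Filter Topology Asymptotics
open scoped ENNReal

noncomputable section

/-- `m` minimizes `c ↦ ‖u - c‖` over the reals, the norm being that of `L^p` on the closed ball
of radius `ε` about `x`, with Lebesgue measure. -/
def IsPMean {N : ℕ} (p : ℝ≥0∞) (ε : ℝ) (u : EuclideanSpace ℝ (Fin N) → ℝ)
    (x : EuclideanSpace ℝ (Fin N)) (m : ℝ) : Prop :=
  ∀ c : ℝ, eLpNorm (fun y => u y - m) p (volume.restrict (Metric.closedBall x ε)) ≤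
    eLpNorm (fun y => u y - c) p (volume.restrict (Metric.closedBall x ε))

/-- The `p`-mean of `u` in the closed ball of radius `ε` about `x`: the minimizer of
`c ↦ ‖u - c‖` (some real number without meaning if there is no minimizer). -/
def pMean {N : ℕ} (p : ℝ≥0∞) (ε : ℝ) (u : EuclideanSpace ℝ (Fin N) → ℝ)
    (x : EuclideanSpace ℝ (Fin N)) : ℝ :=
  Classical.epsilon fun m => IsPMean p ε u x m

/-- The divergence `∑ i, ∂F_i/∂x_i` of a vector field `F`. -/
def divergence {N : ℕ} (F : EuclideanSpace ℝ (Fin N) → EuclideanSpace ℝ (Fin N))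
    (x : EuclideanSpace ℝ (Fin N)) : ℝ :=
  ∑ i : Fin N, (fderiv ℝ F x (EuclideanSpace.single i 1)) i

/-- The normalized `p`-Laplacian `div (|∇u|^(p-2) ∇u) / |∇u|^(p-2)`, for finite `p`. -/
def normalizedPLaplacian {N : ℕ} (p : ℝ) (u : EuclideanSpace ℝ (Fin N) → ℝ)
    (x : EuclideanSpace ℝ (Fin N)) : ℝ :=
  divergence (fun y => ‖gradient u y‖ ^ (p - 2) • gradient u y) x / ‖gradient u x‖ ^ (p - 2)

/-- The normalized infinity-Laplacian `⟨∇²u ∇u, ∇u⟩ / |∇u|^2`, the Hessian `∇²u` being the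
derivative of the gradient. -/
def normalizedInftyLaplacian {N : ℕ} (u : EuclideanSpace ℝ (Fin N) → ℝ)
    (x : EuclideanSpace ℝ (Fin N)) : ℝ :=
  inner ℝ (fderiv ℝ (gradient u) x (gradient u x)) (gradient u x) / ‖gradient u x‖ ^ 2

end

/-!
Existence of a `p`-mean is attainment of the distance to a line in `L^p`. The rest of the argument
for finite `p` uses the function `G c = ∫ φ (u - c)` over the ball, with
`φ t = sign t * |t| ^ (p - 1)` (`signedPow (p - 1)`): up to a negative factor it is a subgradient
of the convex function `c ↦ ∫ |u - c| ^ p`, also for `p = 1`. Hence every minimizer lies to the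
left of each `c` with `G c < 0` and to the right of each `c` with `0 < G c`
(`IsPMean.le_of_integral_neg`, `IsPMean.ge_of_integral_pos`). Two distinct minimizers would make
`G` vanish on the interval between them, which connectedness of the ball excludes
(`false_of_integral_signedPow_sub_eq_zero`).

For the asymptotics put `ξ = ∇u x`, `H = ∇²u x`, and rescale to the unit ball `B`. By Taylor's
formula and the monotonicity of `φ`, the sign of `G` at `u x + c * ε ^ 2` is controlled by
`g ε = ∫_B φ (⟪ξ, y⟫ + ε * (⟪H y, y⟫ / 2 - c'))` with `c'` close to `c`. Since `φ` is odd,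
`g 0 = 0`, and the claim becomes that `g ε / ε` tends to `κ * (L - c')`, where `κ > 0` and `L` is
the coefficient in the theorem (`exists_tendsto_integral_signedPow_inner`). For `1 < p` this is
differentiation under the integral sign, the weight being `|⟪ξ, y⟫| ^ (p - 2)`. For `p = 1` the
sign changes only in a layer of thickness `ε` about the equator `⟪ξ, y⟫ = 0`; rescaling this layer
gives an integral over the equatorial ball. In both cases `L` comes from second moments of a ball
with respect to a power weight, which are computed by slicing perpendicularly to `ξ`; the constant
`N + p` comes from the one-dimensional identity `integral_abs_rpow_mul_sq`, used with the exponent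
`0` in an induction on the dimension (`setIntegral_sqBall_dotProduct_mulVec`) and with the
exponent `p - 2` at the end (`setIntegral_splitBall_abs_rpow_mul_splitForm`).

For `p = ∞` the mean is the midpoint of the range of `u` (`IsPMean.eq_midpoint`). Moving away from
the direction `±ξ` by a distance `d` costs at least `ε * ‖ξ‖ * d ^ 2 / 2` in the linear part and
gains at most `ε ^ 2 * ‖H‖ * d` in the quadratic part, so up to `o(ε ^ 2)` the extrema are the
values of the Taylor polynomial at `±ε ξ / ‖ξ‖`; the linear parts cancel in the midpoint.
-/

/-! ### The odd power function -/

/-- The odd power function `t ↦ sign t * |t| ^ q`. For `q = p - 1` it is, up to the factor `p`,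
the derivative of `|t| ^ p`; for `q = 0` it is the sign function, with value `0` at `0`. -/
noncomputable def signedPow (q t : ℝ) : ℝ := Real.sign t * |t| ^ q

theorem signedPow_of_pos (q : ℝ) {t : ℝ} (ht : 0 < t) : signedPow q t = t ^ q := by
  simp [signedPow, Real.sign_of_pos ht, abs_of_pos ht]

theorem signedPow_of_neg (q : ℝ) {t : ℝ} (ht : t < 0) : signedPow q t = -(-t) ^ q := by
  simp [signedPow, Real.sign_of_neg ht, abs_of_neg ht]

@[simp] theorem signedPow_zero (q : ℝ) : signedPow q 0 = 0 := by simp [signedPow]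

theorem signedPow_neg (q t : ℝ) : signedPow q (-t) = -signedPow q t := by
  simp [signedPow, Real.sign_neg]

theorem signedPow_pos (q : ℝ) {t : ℝ} (ht : 0 < t) : 0 < signedPow q t := by
  rw [signedPow_of_pos q ht]; positivity

theorem signedPow_lt_zero (q : ℝ) {t : ℝ} (ht : t < 0) : signedPow q t < 0 := by
  have := signedPow_pos q (neg_pos.2 ht)
  rw [signedPow_neg] at this; linarith

theorem signedPow_mul_of_pos (q : ℝ) {c : ℝ} (hc : 0 < c) (t : ℝ) :
    signedPow q (c * t) = c ^ q * signedPow q t := by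
  rcases lt_trichotomy t 0 with h | rfl | h
  · rw [signedPow_of_neg q h, signedPow_of_neg q (mul_neg_of_pos_of_neg hc h), ← mul_neg,
      Real.mul_rpow hc.le (by linarith)]
    ring
  · simp
  · rw [signedPow_of_pos q h, signedPow_of_pos q (mul_pos hc h), Real.mul_rpow hc.le h.le]

theorem monotone_signedPow {q : ℝ} (hq : 0 ≤ q) : Monotone (signedPow q) := by
  have key : ∀ {a b : ℝ}, 0 < a → a ≤ b → signedPow q a ≤ signedPow q b := by
    intro a b ha hab
    rw [signedPow_of_pos q ha, signedPow_of_pos q (ha.trans_le hab)]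
    exact Real.rpow_le_rpow ha.le hab hq
  intro a b hab
  rcases lt_trichotomy a 0 with ha | rfl | ha
  · rcases lt_trichotomy b 0 with hb | rfl | hb
    · have := key (neg_pos.2 hb) (neg_le_neg hab)
      rw [signedPow_neg, signedPow_neg] at this; linarith
    · simpa using (signedPow_lt_zero q ha).le
    · exact ((signedPow_lt_zero q ha).trans (signedPow_pos q hb)).le
  · rcases hab.eq_or_lt with rfl | hb
    · exact le_rfl
    · simpa using (signedPow_pos q hb).le
  · exact key ha hab

theorem measurable_signedPow {q : ℝ} (hq : 0 ≤ q) : Measurable (signedPow q) :=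
  (monotone_signedPow hq).measurable

theorem abs_signedPow_le (q t : ℝ) : |signedPow q t| ≤ |t| ^ q := by
  have h : |Real.sign t| ≤ 1 := by
    rcases Real.sign_apply_eq t with h | h | h <;> simp [h]
  rw [signedPow, abs_mul, abs_of_nonneg (by positivity : 0 ≤ |t| ^ q)]
  exact mul_le_of_le_one_left (by positivity) h

theorem signedPow_zero_eq_sign (t : ℝ) : signedPow 0 t = Real.sign t := by simp [signedPow]

/-- `p * signedPow (p - 1) b` is a subgradient of `|·| ^ p` at `b`, also for `p = 1`. -/
theorem mul_signedPow_mul_sub_le {p : ℝ} (hp : 1 ≤ p) (a b : ℝ) :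
    p * signedPow (p - 1) b * (a - b) ≤ |a| ^ p - |b| ^ p := by
  have one : ∀ s : ℝ, p * (s - 1) ≤ |s| ^ p - 1 := by
    intro s
    rcases le_or_gt 0 s with hs | hs
    · have := one_add_mul_self_le_rpow_one_add (s := s - 1) (by linarith) hp
      rw [abs_of_nonneg hs]; simp only [add_sub_cancel] at this; linarith
    · have : 0 ≤ |s| ^ p := by positivity
      nlinarith
  have pos : ∀ a b : ℝ, 0 < b → p * signedPow (p - 1) b * (a - b) ≤ |a| ^ p - |b| ^ p := by
    intro a b hb
    have h := mul_le_mul_of_nonneg_left (one (a / b)) (by positivity : 0 ≤ b ^ p)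
    rw [abs_div, Real.div_rpow (abs_nonneg _) (abs_nonneg _), abs_of_pos hb] at h
    rw [signedPow_of_pos _ hb, Real.rpow_sub_one hb.ne', abs_of_pos hb]
    have hbp : b ^ p ≠ 0 := by positivity
    calc p * (b ^ p / b) * (a - b) = b ^ p * (p * (a / b - 1)) := by field_simp
      _ ≤ _ := h
      _ = _ := by field_simp
  rcases lt_trichotomy b 0 with hb | rfl | hb
  · have := pos (-a) (-b) (neg_pos.2 hb)
    rw [signedPow_neg, abs_neg, abs_neg] at this
    linarith
  · have : 0 ≤ |a| ^ p := by positivity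
    simpa [Real.zero_rpow (by linarith : p ≠ 0)] using this
  · exact pos a b hb

theorem hasDerivAt_signedPow (q : ℝ) {a : ℝ} (ha : a ≠ 0) :
    HasDerivAt (signedPow q) (q * |a| ^ (q - 1)) a := by
  rcases lt_or_gt_of_ne ha with h | h
  · have h1 := ((hasDerivAt_neg a).rpow_const (p := q) (Or.inl (by linarith))).neg
    have h2 : HasDerivAt (fun t : ℝ => -(-t) ^ q) (q * |a| ^ (q - 1)) a :=
      h1.congr_deriv (by rw [abs_of_neg h]; ring)
    refine h2.congr_of_eventuallyEq ?_
    filter_upwards [gt_mem_nhds h] with t ht using signedPow_of_neg q ht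
  · have h1 := (hasDerivAt_id a).rpow_const (p := q) (Or.inl ha)
    have h2 : HasDerivAt (fun t : ℝ => t ^ q) (q * |a| ^ (q - 1)) a :=
      h1.congr_deriv (by rw [abs_of_pos h]; simp)
    refine h2.congr_of_eventuallyEq ?_
    filter_upwards [lt_mem_nhds h] with t ht using signedPow_of_pos q ht

/-- For `q ≤ 1` the increments of `signedPow q` at `a` are linearly bounded, with a constant that
is singular at `a = 0` but, for `0 < q`, locally integrable in `a`. -/
theorem abs_signedPow_add_sub_le_of_le_one {q : ℝ} (hq : 0 ≤ q) (hq1 : q ≤ 1) {a : ℝ} (ha : a ≠ 0)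
    (h : ℝ) : |signedPow q (a + h) - signedPow q a| ≤ 2 * |a| ^ (q - 1) * |h| := by
  have one : ∀ r : ℝ, |signedPow q (1 + r) - 1| ≤ 2 * |r| := by
    intro r
    rcases lt_trichotomy (1 + r) 0 with h0 | h0 | h0
    · rw [signedPow_of_neg q h0]
      have hr : r < -1 := by linarith
      have h1 : (-(1 + r)) ^ q ≤ (-r) ^ q := Real.rpow_le_rpow (by linarith) (by linarith) hq
      have h2 : (-r) ^ q ≤ (-r) ^ (1 : ℝ) :=
        Real.rpow_le_rpow_of_exponent_le (by linarith) hq1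
      have h3 : 0 ≤ (-(1 + r)) ^ q := Real.rpow_nonneg (by linarith) _
      rw [Real.rpow_one] at h2
      rw [abs_of_neg (by linarith), abs_of_neg (by linarith)]
      linarith
    · rw [h0, signedPow_zero]
      have : r = -1 := by linarith
      simp [this]
    · rw [signedPow_of_pos q h0]
      rcases le_total 0 r with hr | hr
      · have h1 : (1 + r) ^ q ≤ (1 + r) ^ (1 : ℝ) :=
          Real.rpow_le_rpow_of_exponent_le (by linarith) hq1
        have h2 : 1 ≤ (1 + r) ^ q := Real.one_le_rpow (by linarith) hq
        rw [Real.rpow_one] at h1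
        rw [abs_of_nonneg (by linarith), abs_of_nonneg hr]
        linarith
      · have h1 : (1 + r) ^ (1 : ℝ) ≤ (1 + r) ^ q :=
          Real.rpow_le_rpow_of_exponent_ge h0 (by linarith) hq1
        have h2 : (1 + r) ^ q ≤ 1 := Real.rpow_le_one h0.le (by linarith) hq
        rw [Real.rpow_one] at h1
        rw [abs_of_nonpos (by linarith), abs_of_nonpos hr]
        linarith
  have pos : ∀ a h : ℝ, 0 < a →
      |signedPow q (a + h) - signedPow q a| ≤ 2 * |a| ^ (q - 1) * |h| := by
    intro a h ha
    have h1 : signedPow q (a + h) - signedPow q a = a ^ q * (signedPow q (1 + h / a) - 1) := by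
      rw [show a + h = a * (1 + h / a) by field_simp, signedPow_mul_of_pos q ha,
        signedPow_of_pos q ha]
      ring
    rw [h1, abs_mul, abs_of_pos (by positivity : 0 < a ^ q), abs_of_pos ha,
      Real.rpow_sub_one ha.ne']
    calc a ^ q * |signedPow q (1 + h / a) - 1| ≤ a ^ q * (2 * |h / a|) := by
          gcongr; exact one _
      _ = _ := by rw [abs_div, abs_of_pos ha]; ring
  rcases lt_or_gt_of_ne ha with h0 | h0
  · have := pos (-a) (-h) (neg_pos.2 h0)
    rwa [← neg_add, signedPow_neg, signedPow_neg, abs_neg, abs_neg, ← neg_sub', abs_neg] at this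
  · exact pos a h h0

/-- For `1 ≤ q` the function `signedPow q` is locally Lipschitz. -/
theorem abs_signedPow_sub_le_of_one_le {q : ℝ} (hq : 1 ≤ q) {R a b : ℝ} (ha : |a| ≤ R)
    (hb : |b| ≤ R) : |signedPow q b - signedPow q a| ≤ q * R ^ (q - 1) * |b - a| := by
  have hR : 0 ≤ R := (abs_nonneg a).trans ha
  have pos : ∀ {a b : ℝ}, 0 < a → a ≤ b → b ≤ R →
      |signedPow q b - signedPow q a| ≤ q * R ^ (q - 1) * |b - a| := by
    intro a b ha hab hb
    refine (convex_Icc a b).norm_image_sub_le_of_norm_hasDerivWithin_le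
      (f := signedPow q) (f' := fun t => q * |t| ^ (q - 1)) (fun t ht => ?_) (fun t ht => ?_)
      (Set.left_mem_Icc.2 hab) (Set.right_mem_Icc.2 hab)
    · exact (hasDerivAt_signedPow q (ha.trans_le ht.1).ne').hasDerivWithinAt
    · rw [Real.norm_of_nonneg (by positivity), abs_of_pos (ha.trans_le ht.1)]
      have := Real.rpow_le_rpow (ha.trans_le ht.1).le (ht.2.trans hb) (by linarith : 0 ≤ q - 1)
      gcongr
  have bound : ∀ {a : ℝ}, |a| ≤ R → |signedPow q a| ≤ q * R ^ (q - 1) * |a| := by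
    intro a ha
    rcases eq_or_ne a 0 with rfl | h0
    · simp
    have h0' : 0 < |a| := abs_pos.2 h0
    have h1 : |a| ^ (q - 1) ≤ R ^ (q - 1) := Real.rpow_le_rpow h0'.le ha (by linarith)
    have h2 : |a| ^ q = |a| ^ (q - 1) * |a| := by
      rw [Real.rpow_sub_one h0'.ne']; field_simp
    calc |signedPow q a| ≤ |a| ^ q := abs_signedPow_le q a
      _ = 1 * |a| ^ (q - 1) * |a| := by rw [h2, one_mul]
      _ ≤ q * R ^ (q - 1) * |a| := by gcongr
  have main : ∀ {a b : ℝ}, a ≤ b → |a| ≤ R → |b| ≤ R →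
      |signedPow q b - signedPow q a| ≤ q * R ^ (q - 1) * |b - a| := by
    intro a b hab ha hb
    rcases lt_or_ge 0 a with h0 | h0
    · exact pos h0 hab ((le_abs_self b).trans hb)
    rcases lt_or_ge b 0 with h1 | h1
    · have := pos (neg_pos.2 h1) (neg_le_neg hab) ((neg_le_abs a).trans ha)
      rw [signedPow_neg, signedPow_neg] at this
      rwa [show signedPow q b - signedPow q a = -signedPow q a - -signedPow q b by ring,
        show b - a = -a - -b by ring]
    · calc |signedPow q b - signedPow q a| ≤ |signedPow q b| + |signedPow q a| := abs_sub _ _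
        _ ≤ q * R ^ (q - 1) * |b| + q * R ^ (q - 1) * |a| := add_le_add (bound hb) (bound ha)
        _ = q * R ^ (q - 1) * |b - a| := by
          rw [abs_of_nonneg h1, abs_of_nonpos h0, abs_of_nonneg (by linarith)]; ring
  rcases le_total a b with hab | hab
  · exact main hab ha hb
  · rw [abs_sub_comm, abs_sub_comm b]; exact main hab hb ha

/-! ### Existence, uniqueness and location of `p`-means -/

theorem memLp_sub_const {N : ℕ} (p : ℝ≥0∞) {x : EuclideanSpace ℝ (Fin N)} {ε : ℝ}
    {u : EuclideanSpace ℝ (Fin N) → ℝ} (hu : ContinuousOn u (Metric.closedBall x ε)) (c : ℝ) :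
    MemLp (fun y => u y - c) p (volume.restrict (Metric.closedBall x ε)) := by
  have hc : ContinuousOn (fun y => u y - c) (Metric.closedBall x ε) := hu.sub continuousOn_const
  obtain ⟨C, hC⟩ := (isCompact_closedBall x ε).exists_bound_of_continuousOn hc
  have : IsFiniteMeasure (volume.restrict (Metric.closedBall x ε)) :=
    ⟨by simpa using (isCompact_closedBall x ε).measure_lt_top⟩
  exact MemLp.of_bound (hc.aestronglyMeasurable Metric.isClosed_closedBall.measurableSet) C
    ((ae_restrict_iff' Metric.isClosed_closedBall.measurableSet).2 (ae_of_all _ hC))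

theorem measure_closedBall_restrict_ne_zero {N : ℕ} (x : EuclideanSpace ℝ (Fin N)) {ε : ℝ}
    (hε : 0 < ε) : volume.restrict (Metric.closedBall x ε) ≠ 0 := by
  rw [Ne, Measure.restrict_eq_zero]
  exact (Metric.measure_closedBall_pos volume x hε).ne'

/-- A `p`-mean exists: the distance in `L^p` from `u` to the constants is attained, as the
constants form a line. -/
theorem exists_isPMean {N : ℕ} {p : ℝ≥0∞} (hp : 1 ≤ p) {x : EuclideanSpace ℝ (Fin N)} {ε : ℝ}
    (hε : 0 < ε) {u : EuclideanSpace ℝ (Fin N) → ℝ}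
    (hu : ContinuousOn u (Metric.closedBall x ε)) : ∃ m, IsPMean p ε u x m := by
  have : Fact (1 ≤ p) := ⟨hp⟩
  set μ := volume.restrict (Metric.closedBall x ε) with hμ
  have : IsFiniteMeasure μ := ⟨by simpa [hμ] using (isCompact_closedBall x ε).measure_lt_top⟩
  have hU : MemLp u p μ := by simpa using memLp_sub_const p hu 0
  have hI : MemLp (fun _ : EuclideanSpace ℝ (Fin N) => (1 : ℝ)) p μ := memLp_const 1
  set U := hU.toLp u
  set I := hI.toLp (fun _ : EuclideanSpace ℝ (Fin N) => (1 : ℝ))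
  have hI0 : 0 < ‖I‖ := by
    rw [Lp.norm_toLp, ENNReal.toReal_pos_iff]
    refine ⟨?_, hI.eLpNorm_lt_top⟩
    rw [pos_iff_ne_zero, Ne, eLpNorm_eq_zero_iff hI.1 (by positivity)]
    intro h
    have : NeZero μ := ⟨measure_closedBall_restrict_ne_zero x hε⟩
    obtain ⟨y, hy⟩ := h.exists
    simp at hy
  have hnorm : ∀ c : ℝ, ENNReal.ofReal ‖U - c • I‖ = eLpNorm (fun y => u y - c) p μ := by
    intro c
    have hm := memLp_sub_const p hu c
    have : U - c • I = hm.toLp _ := by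
      rw [← MemLp.toLp_const_smul, ← MemLp.toLp_sub]
      refine MemLp.toLp_congr _ _ (ae_of_all _ fun y => ?_)
      simp
    rw [this, Lp.norm_toLp, ENNReal.ofReal_toReal hm.eLpNorm_lt_top.ne]
  have hcont : Continuous fun c : ℝ => ‖U - c • I‖ := by fun_prop
  have hlim : Tendsto (fun c : ℝ => ‖U - c • I‖) (cocompact ℝ) atTop := by
    have h1 : Tendsto (fun c : ℝ => ‖c‖ * ‖I‖ - ‖U‖) (cocompact ℝ) atTop :=
      tendsto_atTop_add_const_right _ _ (tendsto_norm_cocompact_atTop.atTop_mul_const hI0)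
    refine tendsto_atTop_mono (fun c => ?_) h1
    rw [← norm_smul, norm_sub_rev]
    exact norm_sub_norm_le _ _
  obtain ⟨m, hm⟩ := hcont.exists_forall_le hlim
  refine ⟨m, fun c => ?_⟩
  rw [← hnorm, ← hnorm]
  exact ENNReal.ofReal_le_ofReal (hm c)

theorem isPMean_iff_integral {N : ℕ} {p : ℝ} (hp : 1 ≤ p) {x : EuclideanSpace ℝ (Fin N)} {ε : ℝ}
    {u : EuclideanSpace ℝ (Fin N) → ℝ} (hu : ContinuousOn u (Metric.closedBall x ε)) (m : ℝ) :
    IsPMean (ENNReal.ofReal p) ε u x m ↔ ∀ c : ℝ,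
      ∫ y in Metric.closedBall x ε, |u y - m| ^ p ≤
        ∫ y in Metric.closedBall x ε, |u y - c| ^ p := by
  refine forall_congr' fun c => ?_
  have h0 : ENNReal.ofReal p ≠ 0 := by simp; linarith
  have hpr : (ENNReal.ofReal p).toReal = p := ENNReal.toReal_ofReal (by linarith)
  have hnn : ∀ c : ℝ, 0 ≤ ∫ y in Metric.closedBall x ε, |u y - c| ^ p :=
    fun c => integral_nonneg fun y => by positivity
  rw [(memLp_sub_const _ hu m).eLpNorm_eq_integral_rpow_norm h0 ENNReal.ofReal_ne_top,
    (memLp_sub_const _ hu c).eLpNorm_eq_integral_rpow_norm h0 ENNReal.ofReal_ne_top, hpr]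
  simp only [Real.norm_eq_abs]
  rw [ENNReal.ofReal_le_ofReal_iff (Real.rpow_nonneg (hnn c) _),
    Real.rpow_le_rpow_iff (hnn m) (hnn c) (by positivity)]

theorem integrableOn_abs_sub_rpow {N : ℕ} {p : ℝ} (hp : 0 ≤ p) {x : EuclideanSpace ℝ (Fin N)}
    {ε : ℝ} {u : EuclideanSpace ℝ (Fin N) → ℝ} (hu : ContinuousOn u (Metric.closedBall x ε))
    (c : ℝ) : IntegrableOn (fun y => |u y - c| ^ p) (Metric.closedBall x ε) :=
  (((hu.sub continuousOn_const).abs).rpow_const fun _ _ => Or.inr hp).integrableOn_compact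
    (isCompact_closedBall x ε)

theorem integrableOn_signedPow_sub {N : ℕ} {q : ℝ} (hq : 0 ≤ q) {x : EuclideanSpace ℝ (Fin N)}
    {ε : ℝ} {u : EuclideanSpace ℝ (Fin N) → ℝ} (hu : ContinuousOn u (Metric.closedBall x ε))
    (c : ℝ) : IntegrableOn (fun y => signedPow q (u y - c)) (Metric.closedBall x ε) := by
  refine Integrable.mono' (integrableOn_abs_sub_rpow hq hu c) ?_
    (ae_of_all _ fun y => abs_signedPow_le q _)
  exact ((measurable_signedPow hq).comp_aemeasurable
    ((hu.sub continuousOn_const).aemeasurable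
      Metric.isClosed_closedBall.measurableSet)).aestronglyMeasurable

/-- The convexity of `c ↦ ∫ |u - c| ^ p`, in the form of its tangent lines. -/
theorem integral_abs_sub_rpow_sub_ge {N : ℕ} {p : ℝ} (hp : 1 ≤ p) {x : EuclideanSpace ℝ (Fin N)}
    {ε : ℝ} {u : EuclideanSpace ℝ (Fin N) → ℝ} (hu : ContinuousOn u (Metric.closedBall x ε))
    (c m : ℝ) :
    p * (c - m) * ∫ y in Metric.closedBall x ε, signedPow (p - 1) (u y - c) ≤
      (∫ y in Metric.closedBall x ε, |u y - m| ^ p) -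
        ∫ y in Metric.closedBall x ε, |u y - c| ^ p := by
  have hp0 : 0 ≤ p := by linarith
  rw [← integral_const_mul, ← integral_sub (integrableOn_abs_sub_rpow hp0 hu m)
    (integrableOn_abs_sub_rpow hp0 hu c)]
  refine integral_mono ((integrableOn_signedPow_sub (by linarith) hu c).const_mul _)
    ((integrableOn_abs_sub_rpow hp0 hu m).sub (integrableOn_abs_sub_rpow hp0 hu c)) fun y => ?_
  have := mul_signedPow_mul_sub_le hp (u y - m) (u y - c)
  rw [show u y - m - (u y - c) = c - m by ring] at this
  linarith

/-- A point `c` at which the integral, a negative multiple of a subgradient, is negative lies to the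
right of every `p`-mean. -/
theorem IsPMean.le_of_integral_neg {N : ℕ} {p : ℝ} (hp : 1 ≤ p) {x : EuclideanSpace ℝ (Fin N)}
    {ε : ℝ} {u : EuclideanSpace ℝ (Fin N) → ℝ} (hu : ContinuousOn u (Metric.closedBall x ε))
    {m c : ℝ} (hm : IsPMean (ENNReal.ofReal p) ε u x m)
    (hc : ∫ y in Metric.closedBall x ε, signedPow (p - 1) (u y - c) < 0) : m ≤ c := by
  by_contra! h
  have h1 := integral_abs_sub_rpow_sub_ge hp hu c m
  have h2 := (isPMean_iff_integral hp hu m).1 hm c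
  have h3 := mul_pos_of_neg_of_neg
    (mul_neg_of_pos_of_neg (by linarith : 0 < p) (sub_neg.2 h)) hc
  linarith

theorem IsPMean.ge_of_integral_pos {N : ℕ} {p : ℝ} (hp : 1 ≤ p) {x : EuclideanSpace ℝ (Fin N)}
    {ε : ℝ} {u : EuclideanSpace ℝ (Fin N) → ℝ} (hu : ContinuousOn u (Metric.closedBall x ε))
    {m c : ℝ} (hm : IsPMean (ENNReal.ofReal p) ε u x m)
    (hc : 0 < ∫ y in Metric.closedBall x ε, signedPow (p - 1) (u y - c)) : c ≤ m := by
  by_contra! h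
  have h1 := integral_abs_sub_rpow_sub_ge hp hu c m
  have h2 := (isPMean_iff_integral hp hu m).1 hm c
  have h3 := mul_pos (mul_pos (by linarith : 0 < p) (sub_pos.2 h)) hc
  linarith

/-- The subgradient vanishes at one point at most. If it vanished at `c < c'`, the integrands
would agree almost everywhere, so that `u` would omit the values in `(c, c')`; as the ball is
connected, `u` would stay on one side of this gap, where one of the integrands has a strict sign.
This covers `q = 0`, where `signedPow q` is not strictly monotone. -/
theorem false_of_integral_signedPow_sub_eq_zero {N : ℕ} {q : ℝ} (hq : 0 ≤ q)
    {x : EuclideanSpace ℝ (Fin N)} {ε : ℝ} (hε : 0 < ε) {u : EuclideanSpace ℝ (Fin N) → ℝ}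
    (hu : ContinuousOn u (Metric.closedBall x ε)) {c c' : ℝ} (hcc : c < c')
    (h0 : ∫ y in Metric.closedBall x ε, signedPow q (u y - c) = 0)
    (h0' : ∫ y in Metric.closedBall x ε, signedPow q (u y - c') = 0) : False := by
  set K := Metric.closedBall x ε with hK
  have hKm : MeasurableSet K := Metric.isClosed_closedBall.measurableSet
  have hub : ContinuousOn u (Metric.ball x ε) := hu.mono Metric.ball_subset_closedBall
  have hae : ∀ᵐ y ∂(volume.restrict K), signedPow q (u y - c) - signedPow q (u y - c') = 0 := by
    have hnn : 0 ≤ fun y => signedPow q (u y - c) - signedPow q (u y - c') := fun y =>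
      sub_nonneg.2 (monotone_signedPow hq (by linarith))
    have := (integral_eq_zero_iff_of_nonneg hnn ((integrableOn_signedPow_sub hq hu c).sub
      (integrableOn_signedPow_sub hq hu c'))).1 (by
        rw [integral_sub (integrableOn_signedPow_sub hq hu c)
          (integrableOn_signedPow_sub hq hu c'), h0, h0', sub_zero])
    exact this
  have hgap : Metric.ball x ε ∩ u ⁻¹' Set.Ioo c c' = ∅ := by
    have hopen := hub.isOpen_inter_preimage Metric.isOpen_ball isOpen_Ioo (t := Set.Ioo c c')
    refine (hopen.measure_eq_zero_iff volume).1 ?_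
    rw [ae_restrict_iff' hKm] at hae
    refine measure_mono_null (fun y hy => ?_) hae
    simp only [Set.mem_ofPred_eq, Set.mem_compl_iff, not_forall]
    refine ⟨Metric.ball_subset_closedBall hy.1, ?_⟩
    have h1 := signedPow_pos q (sub_pos.2 hy.2.1)
    have h2 := signedPow_lt_zero q (sub_neg.2 hy.2.2)
    linarith
  have hconn : IsPreconnected (u '' Metric.ball x ε) :=
    ((convex_ball x ε).isPreconnected).image u hub
  have hside : (∀ y ∈ Metric.ball x ε, u y ≤ c) ∨ (∀ y ∈ Metric.ball x ε, c' ≤ u y) := by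
    by_contra! h
    obtain ⟨⟨y, hy, hcy⟩, z, hz, hcz⟩ := h
    have hy' : c' ≤ u y := by
      by_contra! h
      exact (hgap ▸ (⟨hy, hcy, h⟩ : y ∈ Metric.ball x ε ∩ u ⁻¹' Set.Ioo c c') :
        y ∈ (∅ : Set _))
    have hz' : u z ≤ c := by
      by_contra! h
      exact (hgap ▸ (⟨hz, h, hcz⟩ : z ∈ Metric.ball x ε ∩ u ⁻¹' Set.Ioo c c') :
        z ∈ (∅ : Set _))
    obtain ⟨w, hw, hwe⟩ := hconn.ordConnected.out (Set.mem_image_of_mem u hz)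
      (Set.mem_image_of_mem u hy) (⟨by linarith, by linarith⟩ : (c + c') / 2 ∈ Set.Icc (u z) (u y))
    exact (hgap ▸ (⟨hw, by rw [hwe]; linarith, by rw [hwe]; linarith⟩ :
      w ∈ Metric.ball x ε ∩ u ⁻¹' Set.Ioo c c') : w ∈ (∅ : Set _))
  have hcl : closure (Metric.ball x ε) = K := closure_ball x hε.ne'
  have hvol : 0 < volume K := Metric.measure_closedBall_pos volume x hε
  have huK : ContinuousOn u (closure (Metric.ball x ε)) := by rwa [hcl]
  rcases hside with h | h
  · have hle : ∀ y ∈ K, u y ≤ c := fun y hy =>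
      le_on_closure h huK continuousOn_const (hcl ▸ hy)
    have hneg : 0 < ∫ y in K, -signedPow q (u y - c') := by
      rw [setIntegral_pos_iff_support_of_nonneg_ae]
      · refine hvol.trans_le (measure_mono fun y hy => ⟨?_, hy⟩)
        have := signedPow_lt_zero q (by linarith [hle y hy] : u y - c' < 0)
        simpa using this.ne
      · refine (ae_restrict_iff' hKm).2 (ae_of_all _ fun y hy => ?_)
        have := signedPow_lt_zero q (by linarith [hle y hy] : u y - c' < 0)
        simpa using this.le
      · exact (integrableOn_signedPow_sub hq hu c').neg
    rw [integral_neg, h0'] at hneg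
    simp at hneg
  · have hle : ∀ y ∈ K, c' ≤ u y := fun y hy =>
      le_on_closure h continuousOn_const huK (hcl ▸ hy)
    have hpos : 0 < ∫ y in K, signedPow q (u y - c) := by
      rw [setIntegral_pos_iff_support_of_nonneg_ae]
      · refine hvol.trans_le (measure_mono fun y hy => ⟨?_, hy⟩)
        have := signedPow_pos q (by linarith [hle y hy] : 0 < u y - c)
        simpa using this.ne'
      · refine (ae_restrict_iff' hKm).2 (ae_of_all _ fun y hy => ?_)
        have := signedPow_pos q (by linarith [hle y hy] : 0 < u y - c)
        simpa using this.le
      · exact integrableOn_signedPow_sub hq hu c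
    rw [h0] at hpos
    exact lt_irrefl _ hpos

theorem IsPMean.unique_of_ne_top {N : ℕ} {p : ℝ} (hp : 1 ≤ p) {x : EuclideanSpace ℝ (Fin N)}
    {ε : ℝ} (hε : 0 < ε) {u : EuclideanSpace ℝ (Fin N) → ℝ}
    (hu : ContinuousOn u (Metric.closedBall x ε)) {m m' : ℝ}
    (hm : IsPMean (ENNReal.ofReal p) ε u x m) (hm' : IsPMean (ENNReal.ofReal p) ε u x m') :
    m = m' := by
  have key : ∀ {m m' : ℝ}, IsPMean (ENNReal.ofReal p) ε u x m →
      IsPMean (ENNReal.ofReal p) ε u x m' → ¬ m < m' := by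
    intro m m' hm hm' h
    have hz : ∀ c ∈ Set.Ioo m m',
        ∫ y in Metric.closedBall x ε, signedPow (p - 1) (u y - c) = 0 := by
      intro c hc
      rcases lt_trichotomy (∫ y in Metric.closedBall x ε, signedPow (p - 1) (u y - c)) 0
        with h1 | h1 | h1
      · exact absurd (hm'.le_of_integral_neg hp hu h1) (not_le.2 hc.2)
      · exact h1
      · exact absurd (hm.ge_of_integral_pos hp hu h1) (not_le.2 hc.1)
    exact false_of_integral_signedPow_sub_eq_zero (by linarith : 0 ≤ p - 1) hε hu
      (by linarith : m + (m' - m) / 3 < m + 2 * (m' - m) / 3)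
      (hz _ ⟨by linarith, by linarith⟩) (hz _ ⟨by linarith, by linarith⟩)
  exact le_antisymm (not_lt.1 (key hm' hm)) (not_lt.1 (key hm hm'))

/-- For continuous functions on a ball the norm of `L^∞` is the supremum norm. -/
theorem eLpNorm_top_le_iff {N : ℕ} {x : EuclideanSpace ℝ (Fin N)} {ε : ℝ} (hε : 0 < ε)
    {v : EuclideanSpace ℝ (Fin N) → ℝ} (hv : ContinuousOn v (Metric.closedBall x ε)) {C : ℝ}
    (hC : 0 ≤ C) :
    eLpNorm v ∞ (volume.restrict (Metric.closedBall x ε)) ≤ ENNReal.ofReal C ↔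
      ∀ y ∈ Metric.closedBall x ε, |v y| ≤ C := by
  have hKm : MeasurableSet (Metric.closedBall x ε) := Metric.isClosed_closedBall.measurableSet
  have hcl : closure (Metric.ball x ε) = Metric.closedBall x ε := closure_ball x hε.ne'
  have hpt : ∀ y, ‖v y‖ₑ ≤ ENNReal.ofReal C ↔ |v y| ≤ C := fun y => by
    rw [← ofReal_norm, ENNReal.ofReal_le_ofReal_iff hC, Real.norm_eq_abs]
  rw [eLpNorm_exponent_top]
  constructor
  · intro h
    have hae : ∀ᵐ y ∂(volume.restrict (Metric.closedBall x ε)), |v y| ≤ C := by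
      filter_upwards [enorm_ae_le_eLpNormEssSup v _] with y hy
      exact (hpt y).1 (hy.trans h)
    have hball : ∀ y ∈ Metric.ball x ε, |v y| ≤ C := by
      have hopen := (hv.mono Metric.ball_subset_closedBall).abs.isOpen_inter_preimage
        Metric.isOpen_ball isOpen_Ioi (t := Set.Ioi C)
      have hnull := (hopen.measure_eq_zero_iff volume).1 <| by
        rw [ae_restrict_iff' hKm] at hae
        refine measure_mono_null (fun y hy => ?_) hae
        simp only [Set.mem_ofPred_eq, Set.mem_compl_iff, not_forall]
        exact ⟨Metric.ball_subset_closedBall hy.1, not_le.2 hy.2⟩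
      intro y hy
      by_contra! h
      exact (hnull ▸ (⟨hy, h⟩ : y ∈ Metric.ball x ε ∩ (fun z => |v z|) ⁻¹' Set.Ioi C) :
        y ∈ (∅ : Set _))
    intro y hy
    have hv' : ContinuousOn (fun z => |v z|) (closure (Metric.ball x ε)) := by
      rw [hcl]; exact hv.abs
    exact le_on_closure hball hv' continuousOn_const (hcl ▸ hy)
  · intro h
    exact essSup_le_of_ae_le _ ((ae_restrict_iff' hKm).2
      (ae_of_all _ fun y hy => (hpt y).2 (h y hy)))

/-- The `∞`-mean is the midpoint of the range. -/
theorem IsPMean.eq_midpoint {N : ℕ} {x : EuclideanSpace ℝ (Fin N)} {ε : ℝ} (hε : 0 < ε)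
    {u : EuclideanSpace ℝ (Fin N) → ℝ} (hu : ContinuousOn u (Metric.closedBall x ε)) {m : ℝ}
    (hm : IsPMean ∞ ε u x m) {y z : EuclideanSpace ℝ (Fin N)} (hy : y ∈ Metric.closedBall x ε)
    (hz : z ∈ Metric.closedBall x ε) (hmax : ∀ w ∈ Metric.closedBall x ε, u w ≤ u y)
    (hmin : ∀ w ∈ Metric.closedBall x ε, u z ≤ u w) : m = (u y + u z) / 2 := by
  have hzy : u z ≤ u y := hmax z hz
  have hsub : ∀ c : ℝ, ContinuousOn (fun w => u w - c) (Metric.closedBall x ε) :=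
    fun c => hu.sub continuousOn_const
  have h1 : eLpNorm (fun w => u w - (u y + u z) / 2) ∞ (volume.restrict (Metric.closedBall x ε)) ≤
      ENNReal.ofReal ((u y - u z) / 2) := by
    rw [eLpNorm_top_le_iff hε (hsub _) (by linarith)]
    intro w hw
    rw [abs_le]
    constructor <;> linarith [hmax w hw, hmin w hw]
  have h2 := (eLpNorm_top_le_iff hε (hsub m) (by linarith)).1
    ((hm ((u y + u z) / 2)).trans h1)
  have h3 := abs_le.1 (h2 y hy)
  have h4 := abs_le.1 (h2 z hz)
  linarith [h3.2, h4.1]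

theorem existsUnique_isPMean {N : ℕ} {p : ℝ≥0∞} (hp : 1 ≤ p) {x : EuclideanSpace ℝ (Fin N)}
    {ε : ℝ} (hε : 0 < ε) {u : EuclideanSpace ℝ (Fin N) → ℝ}
    (hu : ContinuousOn u (Metric.closedBall x ε)) : ∃! m, IsPMean p ε u x m := by
  refine existsUnique_of_exists_of_unique (exists_isPMean hp hε hu) fun m m' hm hm' => ?_
  rcases eq_or_ne p ∞ with rfl | hpt
  · have hne : (Metric.closedBall x ε).Nonempty := Metric.nonempty_closedBall.2 hε.le
    obtain ⟨y, hy, hmax⟩ := (isCompact_closedBall x ε).exists_isMaxOn hne hu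
    obtain ⟨z, hz, hmin⟩ := (isCompact_closedBall x ε).exists_isMinOn hne hu
    rw [hm.eq_midpoint hε hu hy hz hmax hmin, hm'.eq_midpoint hε hu hy hz hmax hmin]
  · rw [← ENNReal.ofReal_toReal hpt] at hm hm'
    exact IsPMean.unique_of_ne_top (by simpa using ENNReal.toReal_mono hpt hp) hε hu hm hm'

theorem isPMean_pMean {N : ℕ} {p : ℝ≥0∞} (hp : 1 ≤ p) {x : EuclideanSpace ℝ (Fin N)}
    {ε : ℝ} (hε : 0 < ε) {u : EuclideanSpace ℝ (Fin N) → ℝ}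
    (hu : ContinuousOn u (Metric.closedBall x ε)) : IsPMean p ε u x (pMean p ε u x) :=
  Classical.epsilon_spec (exists_isPMean hp hε hu)

/-! ### Moments of the unit ball -/

open Matrix in
/-- The open Euclidean ball `∑ zᵢ² < r` of squared radius `r`, in bare coordinates. -/
def sqBall (n : ℕ) (r : ℝ) : Set (Fin n → ℝ) := {z | z ⬝ᵥ z < r}

open Matrix in
/-- The open Euclidean unit ball of `ℝ × ℝⁿ`. The first coordinate is split off because it plays
the role of the direction of the gradient. -/
def splitBall (n : ℕ) : Set (ℝ × (Fin n → ℝ)) := {w | w.1 ^ 2 + w.2 ⬝ᵥ w.2 < 1}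

open Matrix in
/-- A quadratic form on `ℝ × ℝⁿ`, with coefficient `a` in the first coordinate, mixed coefficients
`l`, and matrix `A` in the remaining coordinates. -/
def splitForm {n : ℕ} (a : ℝ) (l : Fin n → ℝ) (A : Matrix (Fin n) (Fin n) ℝ)
    (w : ℝ × (Fin n → ℝ)) : ℝ :=
  a * w.1 ^ 2 + w.1 * (l ⬝ᵥ w.2) + w.2 ⬝ᵥ A *ᵥ w.2

section Moments

open Matrix Pointwise

variable {n : ℕ}

theorem continuous_dotProduct_self : Continuous fun z : Fin n → ℝ => z ⬝ᵥ z := by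
  fun_prop

theorem continuous_splitForm (a : ℝ) (l : Fin n → ℝ) (A : Matrix (Fin n) (Fin n) ℝ) :
    Continuous (splitForm a l A) := by
  unfold splitForm; fun_prop

theorem isOpen_sqBall (r : ℝ) : IsOpen (sqBall n r) :=
  isOpen_lt continuous_dotProduct_self continuous_const

theorem isOpen_splitBall : IsOpen (splitBall n) :=
  isOpen_lt (by fun_prop) continuous_const

theorem dotProduct_self_nonneg' (z : Fin n → ℝ) : 0 ≤ z ⬝ᵥ z :=
  Finset.sum_nonneg fun _ _ => mul_self_nonneg _

theorem sqBall_eq_empty {r : ℝ} (hr : r ≤ 0) : sqBall n r = ∅ :=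
  Set.eq_empty_of_forall_notMem fun z hz => absurd (lt_of_lt_of_le hz hr)
    (not_lt.2 (dotProduct_self_nonneg' z))

theorem sqBall_one_subset : sqBall n 1 ⊆ Metric.closedBall 0 1 := by
  intro z hz
  rw [mem_closedBall_zero_iff, pi_norm_le_iff_of_nonneg zero_le_one]
  intro i
  have h1 : z i * z i ≤ z ⬝ᵥ z :=
    Finset.single_le_sum (f := fun i => z i * z i) (fun j _ => mul_self_nonneg _)
      (Finset.mem_univ i)
  have h2 : z ⬝ᵥ z < 1 := hz
  rw [Real.norm_eq_abs, ← sq_le_one_iff_abs_le_one]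
  nlinarith

theorem abs_fst_lt_one_of_mem_splitBall {w : ℝ × (Fin n → ℝ)} (hw : w ∈ splitBall n) :
    |w.1| < 1 := by
  have h2 : w.1 ^ 2 + w.2 ⬝ᵥ w.2 < 1 := hw
  rw [← sq_lt_one_iff_abs_lt_one]
  linarith [dotProduct_self_nonneg' w.2]

theorem snd_mem_sqBall_of_mem_splitBall {w : ℝ × (Fin n → ℝ)} (hw : w ∈ splitBall n) :
    w.2 ∈ sqBall n 1 := by
  have h2 : w.1 ^ 2 + w.2 ⬝ᵥ w.2 < 1 := hw
  exact (by nlinarith [sq_nonneg w.1] : w.2 ⬝ᵥ w.2 < 1)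

theorem volume_sqBall_lt_top : volume (sqBall n 1) < ∞ :=
  (measure_mono sqBall_one_subset).trans_lt (isCompact_closedBall _ _).measure_lt_top

theorem volume_sqBall_real_pos : 0 < volume.real (sqBall n 1) := by
  refine ENNReal.toReal_pos ?_ volume_sqBall_lt_top.ne
  refine ((isOpen_sqBall 1).measure_pos volume ⟨0, ?_⟩).ne'
  simp [sqBall]

theorem integrableOn_sqBall_of_continuous {f : (Fin n → ℝ) → ℝ} (hf : Continuous f) :
    IntegrableOn f (sqBall n 1) :=
  (hf.continuousOn.integrableOn_compact (isCompact_closedBall 0 1)).mono_set sqBall_one_subset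

theorem exists_splitForm_bound (a : ℝ) (l : Fin n → ℝ) (A : Matrix (Fin n) (Fin n) ℝ) :
    ∃ C, ∀ w ∈ splitBall n, |splitForm a l A w| ≤ C := by
  obtain ⟨C, hC⟩ := (isCompact_closedBall (0 : ℝ × (Fin n → ℝ)) 1).exists_bound_of_continuousOn
    (continuous_splitForm a l A).continuousOn
  refine ⟨C, fun w hw => hC w ?_⟩
  rw [mem_closedBall_zero_iff, Prod.norm_def, max_le_iff]
  exact ⟨(abs_fst_lt_one_of_mem_splitBall hw).le,
    mem_closedBall_zero_iff.1 (sqBall_one_subset (snd_mem_sqBall_of_mem_splitBall hw))⟩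

theorem setIntegral_sqBall_sq {s : ℝ} (hs : 0 < s) (f : (Fin n → ℝ) → ℝ) :
    ∫ z in sqBall n (s ^ 2), f z = s ^ n * ∫ z in sqBall n 1, f (s • z) := by
  have h := Measure.setIntegral_comp_smul_of_pos volume f (sqBall n 1) hs
  have hset : s • sqBall n 1 = sqBall n (s ^ 2) := by
    ext z
    rw [Set.mem_smul_set_iff_inv_smul_mem₀ hs.ne']
    simp only [sqBall, Set.mem_ofPred_eq, smul_dotProduct, dotProduct_smul, smul_eq_mul]
    rw [← mul_assoc, ← mul_inv, inv_mul_lt_iff₀ (by positivity)]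
    ring_nf
  rw [h, hset, Module.finrank_fin_fun, smul_eq_mul, mul_inv_cancel_left₀ (by positivity)]

theorem setIntegral_sqBall_dotProduct (l : Fin n → ℝ) (r : ℝ) :
    ∫ z in sqBall n r, l ⬝ᵥ z = 0 := by
  have h := integral_neg_eq_self ((sqBall n r).indicator fun z => l ⬝ᵥ z) volume
  have h2 : (fun z => (sqBall n r).indicator (fun z => l ⬝ᵥ z) (-z)) =
      fun z => -(sqBall n r).indicator (fun z => l ⬝ᵥ z) z := by
    ext z
    have : -z ∈ sqBall n r ↔ z ∈ sqBall n r := by simp [sqBall]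
    by_cases hz : z ∈ sqBall n r <;> simp [Set.indicator, this, hz]
  rw [h2, integral_neg, integral_indicator (isOpen_sqBall r).measurableSet] at h
  linarith

theorem setIntegral_splitBall {F : ℝ × (Fin n → ℝ) → ℝ} (hF : IntegrableOn F (splitBall n)) :
    ∫ w in splitBall n, F w = ∫ t in (-1 : ℝ)..1, ∫ z in sqBall n (1 - t ^ 2), F (t, z) := by
  have hm : MeasurableSet (splitBall n) := isOpen_splitBall.measurableSet
  have hind : ∀ t : ℝ, ∫ z, (splitBall n).indicator F (t, z) =
      ∫ z in sqBall n (1 - t ^ 2), F (t, z) := by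
    intro t
    rw [← integral_indicator (isOpen_sqBall _).measurableSet]
    congr 1
    ext z
    have : (t, z) ∈ splitBall n ↔ z ∈ sqBall n (1 - t ^ 2) := by
      simp only [splitBall, sqBall, Set.mem_ofPred_eq]
      exact lt_sub_iff_add_lt'.symm
    by_cases hz : z ∈ sqBall n (1 - t ^ 2) <;> simp [Set.indicator, this, hz]
  rw [← integral_indicator hm, Measure.volume_eq_prod, integral_prod _ (by
    rw [← Measure.volume_eq_prod]; exact (integrable_indicator_iff hm).2 hF)]
  simp_rw [hind]
  rw [intervalIntegral.integral_of_le (by norm_num), setIntegral_eq_integral_of_forall_compl_eq_zero]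
  intro t ht
  rw [sqBall_eq_empty, setIntegral_empty]
  by_contra! h
  have := abs_lt.1 ((sq_lt_one_iff_abs_lt_one t).1 (by linarith))
  exact ht ⟨this.1, this.2.le⟩

theorem intervalIntegrable_abs_rpow {α : ℝ} (hα : -1 < α) :
    IntervalIntegrable (fun t : ℝ => |t| ^ α) volume (-1) 1 := by
  have h : IntervalIntegrable (fun t : ℝ => |t| ^ α) volume 0 1 := by
    refine (intervalIntegral.intervalIntegrable_rpow' (a := 0) (b := 1) hα).congr fun t ht => ?_
    rw [Set.uIoc_of_le zero_le_one] at ht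
    simp [abs_of_pos ht.1]
  have h' := (IntervalIntegrable.iff_comp_neg (by simp)).1 h
  simp only [abs_neg, neg_zero] at h'
  exact h'.symm.trans h

theorem continuous_signedPow {q : ℝ} (hq : 0 < q) : Continuous (signedPow q) := by
  rw [continuous_iff_continuousAt]
  intro a
  rcases eq_or_ne a 0 with rfl | ha
  · rw [ContinuousAt, signedPow_zero]
    refine squeeze_zero_norm (abs_signedPow_le q) ?_
    have : Continuous fun t : ℝ => |t| ^ q := continuous_abs.rpow_const fun _ => Or.inr hq.le
    simpa [Real.zero_rpow hq.ne'] using this.tendsto 0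
  · exact (hasDerivAt_signedPow q ha).continuousAt

/-- The one-dimensional identity behind the constant `N + p`: the integral of the derivative of
`sign t * |t| ^ (α + 1) * (1 - t ^ 2) ^ (n / 2 + 1)` vanishes. -/
theorem integral_abs_rpow_mul_sq {α : ℝ} (hα : -1 < α) (n : ℕ) :
    (α + n + 3) * ∫ t in (-1 : ℝ)..1, |t| ^ α * (t ^ 2 * (1 - t ^ 2) ^ ((n : ℝ) / 2)) =
      (α + 1) * ∫ t in (-1 : ℝ)..1, |t| ^ α * (1 - t ^ 2) ^ ((n : ℝ) / 2) := by
  have hcont : Continuous fun t : ℝ => (1 - t ^ 2) ^ ((n : ℝ) / 2) :=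
    (by fun_prop : Continuous fun t : ℝ => 1 - t ^ 2).rpow_const fun _ => Or.inr (by positivity)
  have hcont1 : Continuous fun t : ℝ => (1 - t ^ 2) ^ ((n : ℝ) / 2 + 1) :=
    (by fun_prop : Continuous fun t : ℝ => 1 - t ^ 2).rpow_const fun _ => Or.inr (by positivity)
  have hi0 : IntervalIntegrable (fun t : ℝ => |t| ^ α * (1 - t ^ 2) ^ ((n : ℝ) / 2))
      volume (-1) 1 := (intervalIntegrable_abs_rpow hα).mul_continuousOn hcont.continuousOn
  have hi2 : IntervalIntegrable (fun t : ℝ => |t| ^ α * (t ^ 2 * (1 - t ^ 2) ^ ((n : ℝ) / 2)))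
      volume (-1) 1 := (intervalIntegrable_abs_rpow hα).mul_continuousOn
        (((continuous_id.pow 2).mul hcont).continuousOn)
  have h := integral_eq_of_hasDerivAt_off_countable
    (fun t : ℝ => signedPow (α + 1) t * (1 - t ^ 2) ^ ((n : ℝ) / 2 + 1))
    (fun t : ℝ => (α + 1) * (|t| ^ α * (1 - t ^ 2) ^ ((n : ℝ) / 2)) -
      (α + n + 3) * (|t| ^ α * (t ^ 2 * (1 - t ^ 2) ^ ((n : ℝ) / 2))))
    (a := -1) (b := 1) (Set.countable_singleton 0)
    ((continuous_signedPow (by linarith)).mul hcont1).continuousOn (by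
      rintro t ⟨ht, ht0⟩
      have ht0 : t ≠ 0 := ht0
      rw [min_eq_left (by norm_num), max_eq_right (by norm_num)] at ht
      have hpos : 0 < 1 - t ^ 2 := by nlinarith [ht.1, ht.2]
      have h1 := (hasDerivAt_signedPow (α + 1) ht0).mul
        ((((hasDerivAt_id t).pow 2).const_sub 1).rpow_const (p := (n : ℝ) / 2 + 1)
          (Or.inl hpos.ne'))
      refine h1.congr_deriv ?_
      have e1 : signedPow (α + 1) t * t = |t| ^ α * t ^ 2 := by
        have habs : 0 < |t| := abs_pos.2 ht0
        rw [signedPow, Real.rpow_add_one habs.ne', ← sq_abs]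
        rcases Real.sign_apply_eq_of_ne_zero t ht0 with hs | hs
        · rw [hs, abs_of_neg (by
            by_contra! h; rw [Real.sign_of_pos (lt_of_le_of_ne h ht0.symm)] at hs; norm_num at hs)]
          ring
        · rw [hs, abs_of_pos (by
            by_contra! h; rw [Real.sign_of_neg (lt_of_le_of_ne h ht0)] at hs; norm_num at hs)]
          ring
      have e2 : (1 - t ^ 2) ^ ((n : ℝ) / 2 + 1) = (1 - t ^ 2) ^ ((n : ℝ) / 2) * (1 - t ^ 2) :=
        Real.rpow_add_one hpos.ne' _
      simp only [id, Pi.pow_apply, add_sub_cancel_right, e2]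
      push_cast
      linear_combination (-(2 * ((n : ℝ) / 2 + 1) * (1 - t ^ 2) ^ ((n : ℝ) / 2))) * e1)
    ((hi0.const_mul _).sub (hi2.const_mul _))
  rw [intervalIntegral.integral_sub (hi0.const_mul _) (hi2.const_mul _),
    intervalIntegral.integral_const_mul, intervalIntegral.integral_const_mul] at h
  have h0 : (0 : ℝ) ^ ((n : ℝ) / 2 + 1) = 0 := Real.zero_rpow (by positivity)
  norm_num [h0] at h
  linarith

theorem integrableOn_splitBall_abs_rpow {α : ℝ} (hα : -1 < α) :
    IntegrableOn (fun w : ℝ × (Fin n → ℝ) => |w.1| ^ α) (splitBall n) := by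
  have h1 : IntegrableOn (fun t : ℝ => |t| ^ α) (Set.Ioc (-1) 1) :=
    (intervalIntegrable_iff_integrableOn_Ioc_of_le (by norm_num)).1 (intervalIntegrable_abs_rpow hα)
  have h2 : IntegrableOn (fun _ : Fin n → ℝ => (1 : ℝ)) (sqBall n 1) :=
    integrableOn_sqBall_of_continuous continuous_const
  have h3 := Integrable.mul_prod h1 h2
  simp only [mul_one] at h3
  rw [Measure.prod_restrict, ← Measure.volume_eq_prod] at h3
  refine IntegrableOn.mono_set h3 fun w hw => ?_
  have := abs_lt.1 (abs_fst_lt_one_of_mem_splitBall hw)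
  exact ⟨⟨this.1, this.2.le⟩, snd_mem_sqBall_of_mem_splitBall hw⟩

theorem integrableOn_splitBall_abs_rpow_mul {α : ℝ} (hα : -1 < α) {f : ℝ × (Fin n → ℝ) → ℝ}
    (hf : Continuous f) {C : ℝ} (hC : ∀ w ∈ splitBall n, |f w| ≤ C) :
    IntegrableOn (fun w : ℝ × (Fin n → ℝ) => |w.1| ^ α * f w) (splitBall n) :=
  (integrableOn_splitBall_abs_rpow hα).mul_bdd hf.aestronglyMeasurable
    ((ae_restrict_iff' isOpen_splitBall.measurableSet).2 (ae_of_all _ hC))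

theorem setIntegral_splitBall_abs_rpow {α : ℝ} (hα : -1 < α) :
    ∫ w in splitBall n, |w.1| ^ α =
      volume.real (sqBall n 1) * ∫ t in (-1 : ℝ)..1, |t| ^ α * (1 - t ^ 2) ^ ((n : ℝ) / 2) := by
  rw [setIntegral_splitBall (integrableOn_splitBall_abs_rpow hα),
    ← intervalIntegral.integral_const_mul]
  refine intervalIntegral.integral_congr_Ioo_of_le (by norm_num) fun t ht => ?_
  have hpos : 0 < 1 - t ^ 2 := by nlinarith [ht.1, ht.2]
  have hs : 0 < √(1 - t ^ 2) := Real.sqrt_pos.2 hpos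
  have := setIntegral_sqBall_sq (n := n) hs fun _ => |t| ^ α
  rw [Real.sq_sqrt hpos.le] at this
  rw [this, setIntegral_const, smul_eq_mul, Real.rpow_div_two_eq_sqrt _ hpos.le, Real.rpow_natCast]
  ring

theorem setIntegral_splitBall_abs_rpow_mul_splitForm {α : ℝ} (hα : -1 < α)
    (hP : ∀ A : Matrix (Fin n) (Fin n) ℝ, ((n : ℝ) + 2) * ∫ z in sqBall n 1, z ⬝ᵥ A *ᵥ z =
      volume.real (sqBall n 1) * A.trace)
    (a : ℝ) (l : Fin n → ℝ) (A : Matrix (Fin n) (Fin n) ℝ) :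
    (α + n + 3) * ∫ w in splitBall n, |w.1| ^ α * splitForm a l A w =
      (∫ w in splitBall n, |w.1| ^ α) * ((α + 1) * a + A.trace) := by
  obtain ⟨C, hC⟩ := exists_splitForm_bound a l A
  have hcont : Continuous fun t : ℝ => (1 - t ^ 2) ^ ((n : ℝ) / 2) :=
    (by fun_prop : Continuous fun t : ℝ => 1 - t ^ 2).rpow_const fun _ => Or.inr (by positivity)
  have hi0 : IntervalIntegrable (fun t : ℝ => |t| ^ α * (1 - t ^ 2) ^ ((n : ℝ) / 2))
      volume (-1) 1 := (intervalIntegrable_abs_rpow hα).mul_continuousOn hcont.continuousOn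
  have hi2 : IntervalIntegrable (fun t : ℝ => |t| ^ α * (t ^ 2 * (1 - t ^ 2) ^ ((n : ℝ) / 2)))
      volume (-1) 1 := (intervalIntegrable_abs_rpow hα).mul_continuousOn
        (((continuous_id.pow 2).mul hcont).continuousOn)
  set ω := volume.real (sqBall n 1)
  have hn : (n : ℝ) + 2 ≠ 0 := by positivity
  have hP' : ∫ z in sqBall n 1, z ⬝ᵥ A *ᵥ z = ω * A.trace / (n + 2) := by
    rw [eq_div_iff hn, mul_comm, hP]
  have hslice : ∫ w in splitBall n, |w.1| ^ α * splitForm a l A w =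
      ω * (a - A.trace / (n + 2)) *
        (∫ t in (-1 : ℝ)..1, |t| ^ α * (t ^ 2 * (1 - t ^ 2) ^ ((n : ℝ) / 2))) +
      ω * (A.trace / (n + 2)) *
        ∫ t in (-1 : ℝ)..1, |t| ^ α * (1 - t ^ 2) ^ ((n : ℝ) / 2) := by
    rw [setIntegral_splitBall (integrableOn_splitBall_abs_rpow_mul hα (continuous_splitForm a l A)
      hC), ← intervalIntegral.integral_const_mul, ← intervalIntegral.integral_const_mul,
      ← intervalIntegral.integral_add (hi2.const_mul _) (hi0.const_mul _)]
    refine intervalIntegral.integral_congr_Ioo_of_le (by norm_num) fun t ht => ?_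
    have hpos : 0 < 1 - t ^ 2 := by nlinarith [ht.1, ht.2]
    have hs : 0 < √(1 - t ^ 2) := Real.sqrt_pos.2 hpos
    have h1 := setIntegral_sqBall_sq (n := n) hs fun z => |t| ^ α * splitForm a l A (t, z)
    rw [Real.sq_sqrt hpos.le] at h1
    rw [h1, integral_const_mul]
    have h2 : ∫ z in sqBall n 1, splitForm a l A (t, √(1 - t ^ 2) • z) =
        a * t ^ 2 * ω + (1 - t ^ 2) * (ω * A.trace / (n + 2)) := by
      have e : ∀ z : Fin n → ℝ, splitForm a l A (t, √(1 - t ^ 2) • z) =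
          a * t ^ 2 + t * √(1 - t ^ 2) * (l ⬝ᵥ z) + (1 - t ^ 2) * (z ⬝ᵥ A *ᵥ z) := by
        intro z
        simp only [splitForm, dotProduct_smul, smul_dotProduct, mulVec_smul, smul_eq_mul]
        rw [← mul_assoc (√(1 - t ^ 2)), Real.mul_self_sqrt hpos.le]
        ring
      simp_rw [e]
      rw [integral_add, integral_add, integral_const_mul, integral_const_mul, integral_const_mul, hP',
        setIntegral_sqBall_dotProduct, setIntegral_const]
      · simp only [smul_eq_mul]; ring
      all_goals exact integrableOn_sqBall_of_continuous (by fun_prop)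
    rw [h2, ← Real.rpow_natCast, ← Real.rpow_div_two_eq_sqrt _ hpos.le]
    ring
  have key := integral_abs_rpow_mul_sq hα n
  rw [hslice, setIntegral_splitBall_abs_rpow hα]
  set c0 := ∫ t in (-1 : ℝ)..1, |t| ^ α * (1 - t ^ 2) ^ ((n : ℝ) / 2)
  set c2 := ∫ t in (-1 : ℝ)..1, |t| ^ α * (t ^ 2 * (1 - t ^ 2) ^ ((n : ℝ) / 2))
  have hn' : A.trace / (n + 2) * (n + 2) = A.trace := div_mul_cancel₀ _ hn
  set τ := A.trace / (n + 2)
  linear_combination ω * (a - τ) * key + ω * c0 * hn'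

/-- The coordinates of `ℝⁿ⁺¹` split as `ℝ × ℝⁿ`, compatibly with the balls. -/
theorem setIntegral_sqBall_succ (F : (Fin (n + 1) → ℝ) → ℝ) :
    ∫ y in sqBall (n + 1) 1, F y = ∫ w in splitBall n, F (Fin.cons w.1 w.2) := by
  have h := (volume_preserving_piFinSuccAbove (fun _ : Fin (n + 1) => ℝ) 0).symm
  rw [← h.setIntegral_preimage_emb (MeasurableEquiv.measurableEmbedding _)]
  have hset : (MeasurableEquiv.piFinSuccAbove (fun _ : Fin (n + 1) => ℝ) 0).symm ⁻¹'
      sqBall (n + 1) 1 = splitBall n := by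
    ext w
    simp [sqBall, splitBall, dotProduct, Fin.sum_univ_succ, MeasurableEquiv.piFinSuccAbove, pow_two]
  rw [hset]
  simp [MeasurableEquiv.piFinSuccAbove, Fin.consEquiv]

theorem dotProduct_mulVec_cons (A : Matrix (Fin (n + 1)) (Fin (n + 1)) ℝ) (w : ℝ × (Fin n → ℝ)) :
    (Fin.cons w.1 w.2 : Fin (n + 1) → ℝ) ⬝ᵥ A *ᵥ (Fin.cons w.1 w.2 : Fin (n + 1) → ℝ) =
      splitForm (A 0 0) (fun i => A 0 i.succ + A i.succ 0) (A.submatrix Fin.succ Fin.succ) w := by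
  simp only [splitForm, dotProduct, mulVec, Fin.sum_univ_succ, Fin.cons_zero, Fin.cons_succ,
    submatrix_apply, mul_add, add_mul, Finset.sum_add_distrib, Finset.mul_sum]
  have h2 : ∀ i : Fin n, w.2 i * (A i.succ 0 * w.1) = w.1 * (A i.succ 0 * w.2 i) :=
    fun i => by ring
  simp only [h2]
  ring

theorem trace_eq_add_trace_succ (A : Matrix (Fin (n + 1)) (Fin (n + 1)) ℝ) :
    A.trace = A 0 0 + (A.submatrix Fin.succ Fin.succ).trace := by
  simp [Matrix.trace, Fin.sum_univ_succ]

/-- The second moments of the unit ball. -/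
theorem setIntegral_sqBall_dotProduct_mulVec (n : ℕ) (A : Matrix (Fin n) (Fin n) ℝ) :
    ((n : ℝ) + 2) * ∫ z in sqBall n 1, z ⬝ᵥ A *ᵥ z = volume.real (sqBall n 1) * A.trace := by
  induction n with
  | zero => simp [Matrix.trace, dotProduct]
  | succ n ih =>
    have h := setIntegral_splitBall_abs_rpow_mul_splitForm (α := 0) (by norm_num) ih (A 0 0)
      (fun i => A 0 i.succ + A i.succ 0) (A.submatrix Fin.succ Fin.succ)
    simp only [Real.rpow_zero, one_mul, zero_add] at h
    have hvol := setIntegral_sqBall_succ (n := n) fun _ => 1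
    rw [setIntegral_const, smul_eq_mul, mul_one] at hvol
    rw [setIntegral_sqBall_succ]
    simp_rw [dotProduct_mulVec_cons]
    rw [hvol, trace_eq_add_trace_succ, ← h]
    push_cast
    ring

end Moments

/-! ### Expansion of the subgradient in split coordinates -/

section Limits

open Matrix

variable {n : ℕ}

theorem setIntegral_splitBall_signedPow_fst (q : ℝ) :
    ∫ w in splitBall n, signedPow q w.1 = 0 := by
  have : (volume : Measure (ℝ × (Fin n → ℝ))).IsAddHaarMeasure :=
    Measure.prod.instIsAddHaarMeasure volume volume
  have h := integral_neg_eq_self ((splitBall n).indicator fun w => signedPow q w.1) volume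
  have h2 : (fun w => (splitBall n).indicator (fun w => signedPow q w.1) (-w)) =
      fun w => -(splitBall n).indicator (fun w => signedPow q w.1) w := by
    ext w
    have : -w ∈ splitBall n ↔ w ∈ splitBall n := by simp [splitBall]
    by_cases hw : w ∈ splitBall n <;> simp [Set.indicator, this, hw, signedPow_neg]
  rw [h2, integral_neg, integral_indicator isOpen_splitBall.measurableSet] at h
  linarith

theorem ae_fst_ne_zero : ∀ᵐ w : ℝ × (Fin n → ℝ), w.1 ≠ 0 := by
  rw [Measure.volume_eq_prod]
  exact Measure.quasiMeasurePreserving_fst.ae (Measure.ae_ne volume (0 : ℝ))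

theorem setIntegral_splitBall_abs_rpow_pos {α : ℝ} (hα : -1 < α) :
    0 < ∫ w in splitBall n, |w.1| ^ α := by
  rw [setIntegral_pos_iff_support_of_nonneg_ae (ae_of_all _ fun w => by positivity)
    (integrableOn_splitBall_abs_rpow hα)]
  have hopen : IsOpen ({w : ℝ × (Fin n → ℝ) | w.1 ≠ 0} ∩ splitBall n) :=
    (isOpen_ne_fun continuous_fst continuous_const).inter isOpen_splitBall
  refine (hopen.measure_pos volume ⟨(1 / 2, 0), ?_⟩).trans_le
    (measure_mono (Set.inter_subset_inter_left _ fun w hw => ?_))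
  · constructor
    · simp
    · simp only [splitBall, Set.mem_ofPred_eq, dotProduct_zero]; norm_num
  · have : 0 < |w.1| := abs_pos.2 hw
    exact (Real.rpow_pos_of_pos this α).ne'

theorem volume_splitBall_lt_top : volume (splitBall n) < ∞ := by
  have h := integrableOn_splitBall_abs_rpow (n := n) (α := 0) (by norm_num)
  simp only [Real.rpow_zero] at h
  exact ((integrableOn_const_iff (by simp)).1 h).resolve_left (by simp)

theorem integrableOn_splitBall_signedPow {q : ℝ} (hq : 0 ≤ q) {f : ℝ × (Fin n → ℝ) → ℝ}
    (hf : Continuous f) {C : ℝ} (hC : ∀ w ∈ splitBall n, |f w| ≤ C) :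
    IntegrableOn (fun w => signedPow q (f w)) (splitBall n) := by
  refine IntegrableOn.of_bound volume_splitBall_lt_top
    ((measurable_signedPow hq).comp hf.measurable).aestronglyMeasurable (C ^ q) ?_
  refine (ae_restrict_iff' isOpen_splitBall.measurableSet).2 (ae_of_all _ fun w hw => ?_)
  exact (abs_signedPow_le q _).trans (Real.rpow_le_rpow (abs_nonneg _) (hC w hw) hq)

/-- First-order expansion for `0 < q`, by differentiation under the integral sign. The difference
quotients are dominated by a multiple of `|t| ^ (q - 1)` if `q ≤ 1`, of a constant if `1 ≤ q`. -/
theorem tendsto_integral_signedPow_of_pos {q : ℝ} (hq : 0 < q) {f : ℝ × (Fin n → ℝ) → ℝ}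
    (hf : Continuous f) {C : ℝ} (hC : ∀ w ∈ splitBall n, |f w| ≤ C) :
    Tendsto (fun ε : ℝ => ε⁻¹ * ∫ w in splitBall n, signedPow q (w.1 + ε * f w)) (𝓝[>] 0)
      (𝓝 (q * ∫ w in splitBall n, |w.1| ^ (q - 1) * f w)) := by
  have hDm : MeasurableSet (splitBall n) := isOpen_splitBall.measurableSet
  have hC0 : 0 ≤ C := (abs_nonneg _).trans (hC 0 (by simp [splitBall]))
  have hI : ∀ ε ∈ Set.Ioo (0 : ℝ) 1,
      IntegrableOn (fun w => signedPow q (w.1 + ε * f w)) (splitBall n) := by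
    intro ε hε
    refine integrableOn_splitBall_signedPow hq.le (C := 1 + C) (by fun_prop) fun w hw => ?_
    refine (abs_add_le _ _).trans
      (add_le_add (abs_fst_lt_one_of_mem_splitBall hw).le ?_)
    rw [abs_mul, abs_of_pos hε.1]
    nlinarith [hε.2, hC w hw, abs_nonneg (f w)]
  have hI0 : IntegrableOn (fun w : ℝ × (Fin n → ℝ) => signedPow q w.1) (splitBall n) :=
    integrableOn_splitBall_signedPow hq.le (C := 1) (by fun_prop) fun w hw =>
      (abs_fst_lt_one_of_mem_splitBall hw).le
  have hsmall : ∀ᶠ ε : ℝ in 𝓝[>] 0, ε ∈ Set.Ioo (0 : ℝ) 1 := Ioo_mem_nhdsGT one_pos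
  have hrw : (fun ε : ℝ => ∫ w in splitBall n,
        ε⁻¹ * (signedPow q (w.1 + ε * f w) - signedPow q w.1)) =ᶠ[𝓝[>] 0]
      fun ε : ℝ => ε⁻¹ * ∫ w in splitBall n, signedPow q (w.1 + ε * f w) := by
    filter_upwards [hsmall] with ε hε
    rw [integral_const_mul, integral_sub (hI ε hε) hI0, setIntegral_splitBall_signedPow_fst,
      sub_zero]
  refine Tendsto.congr' hrw ?_
  rw [← integral_const_mul]
  have hae : ∀ᵐ w ∂(volume.restrict (splitBall n)), w.1 ≠ 0 ∧ w ∈ splitBall n :=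
    (ae_restrict_of_ae ae_fst_ne_zero).and (ae_restrict_mem hDm)
  refine tendsto_integral_filter_of_dominated_convergence
    (fun w => 2 * C * |w.1| ^ (q - 1) + q * (1 + C) ^ (q - 1) * C) ?_ ?_ ?_ ?_
  · filter_upwards [hsmall] with ε hε
    exact (((hI ε hε).sub hI0).const_mul _).aestronglyMeasurable
  · filter_upwards [hsmall] with ε hε
    filter_upwards [hae] with w hw
    have hfw := hC w hw.2
    have hw1 := (abs_fst_lt_one_of_mem_splitBall hw.2).le
    have hp1 : 0 ≤ 2 * C * |w.1| ^ (q - 1) := by positivity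
    have hp2 : 0 ≤ q * (1 + C) ^ (q - 1) * C := by positivity
    rw [norm_mul, norm_inv, Real.norm_of_nonneg hε.1.le, Real.norm_eq_abs, inv_mul_le_iff₀ hε.1]
    rcases le_total q 1 with h1 | h1
    · refine (abs_signedPow_add_sub_le_of_le_one hq.le h1 hw.1 _).trans ?_
      rw [abs_mul, abs_of_pos hε.1]
      calc 2 * |w.1| ^ (q - 1) * (ε * |f w|) = ε * (2 * |f w| * |w.1| ^ (q - 1)) := by ring
        _ ≤ ε * (2 * C * |w.1| ^ (q - 1)) := by gcongr; exact hε.1.le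
        _ ≤ _ := mul_le_mul_of_nonneg_left (by linarith) hε.1.le
    · have hb : |w.1 + ε * f w| ≤ 1 + C := by
        refine (abs_add_le _ _).trans (add_le_add hw1 ?_)
        rw [abs_mul, abs_of_pos hε.1]
        nlinarith [hε.2, abs_nonneg (f w)]
      refine (abs_signedPow_sub_le_of_one_le h1 (R := 1 + C) (by linarith) hb).trans ?_
      rw [add_sub_cancel_left, abs_mul, abs_of_pos hε.1]
      calc q * (1 + C) ^ (q - 1) * (ε * |f w|) = ε * (q * (1 + C) ^ (q - 1) * |f w|) := by ring
        _ ≤ ε * (q * (1 + C) ^ (q - 1) * C) := by gcongr; exact hε.1.le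
        _ ≤ _ := mul_le_mul_of_nonneg_left (by linarith) hε.1.le
  · exact ((integrableOn_splitBall_abs_rpow (by linarith)).const_mul _).add
      ((integrableOn_const_iff (by finiteness)).2 (Or.inr volume_splitBall_lt_top))
  · filter_upwards [hae] with w hw
    have h1 : HasDerivAt (fun ε : ℝ => w.1 + ε * f w) (f w) 0 := by
      simpa using ((hasDerivAt_id (0 : ℝ)).mul_const (f w)).const_add w.1
    have h2 : HasDerivAt (signedPow q) (q * |w.1| ^ (q - 1)) (w.1 + 0 * f w) := by
      simpa using hasDerivAt_signedPow q hw.1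
    have h3 := (h2.comp (0 : ℝ) h1).tendsto_slope_zero_right
    simpa [mul_assoc] using h3

theorem integral_signedPow_zero_add_sub (c : ℝ) :
    ∫ s, (signedPow 0 (s + c) - signedPow 0 s) = 2 * c := by
  have key : ∀ c : ℝ, 0 ≤ c → ∫ s, (signedPow 0 (s + c) - signedPow 0 s) = 2 * c := by
    intro c hc
    have : (fun s => signedPow 0 (s + c) - signedPow 0 s) =ᵐ[volume]
        (Set.Ioo (-c) 0).indicator fun _ => (2 : ℝ) := by
      filter_upwards [Measure.ae_ne volume (0 : ℝ), Measure.ae_ne volume (-c)] with s h0 h1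
      simp only [Set.indicator_apply, Set.mem_Ioo, signedPow_zero_eq_sign]
      rcases lt_or_gt_of_ne h0 with h0 | h0
      · rcases lt_or_gt_of_ne h1 with h1 | h1
        · rw [Real.sign_of_neg h0, Real.sign_of_neg (by linarith), if_neg (by intro h; linarith [h.1])]
          ring
        · rw [Real.sign_of_neg h0, Real.sign_of_pos (by linarith), if_pos ⟨h1, h0⟩]
          ring
      · rw [Real.sign_of_pos h0, Real.sign_of_pos (by linarith), if_neg (by intro h; linarith [h.2])]
        ring
    rw [integral_congr_ae this, integral_indicator measurableSet_Ioo, setIntegral_const]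
    simp [Measure.real, hc, mul_comm]
  rcases le_total 0 c with hc | hc
  · exact key c hc
  · have h := key (-c) (by linarith)
    rw [← integral_neg_eq_self] at h
    have e : ∀ s : ℝ, signedPow 0 (-s + -c) - signedPow 0 (-s) =
        -(signedPow 0 (s + c) - signedPow 0 s) := fun s => by
      rw [← neg_add, signedPow_neg, signedPow_neg]; ring
    simp_rw [e] at h
    rw [integral_neg] at h
    linarith

/-- First-order expansion for `q = 0`. The sign changes only where `|t|` is of order `ε`, so
`t = ε * s` is substituted; in the limit there remains an integral over the equator `t = 0`. -/
theorem tendsto_integral_signedPow_zero {f : ℝ × (Fin n → ℝ) → ℝ}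
    (hf : Continuous f) {C : ℝ} (hC : ∀ w ∈ splitBall n, |f w| ≤ C) :
    Tendsto (fun ε : ℝ => ε⁻¹ * ∫ w in splitBall n, signedPow 0 (w.1 + ε * f w)) (𝓝[>] 0)
      (𝓝 (2 * ∫ z in sqBall n 1, f (0, z))) := by
  have hDm : MeasurableSet (splitBall n) := isOpen_splitBall.measurableSet
  have hBm : MeasurableSet (sqBall n 1) := (isOpen_sqBall 1).measurableSet
  have hsm : Measurable (signedPow 0) := measurable_signedPow le_rfl
  have hs1 : ∀ t, |signedPow 0 t| ≤ 1 := fun t => by simpa using abs_signedPow_le 0 t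
  -- the integrand after the substitution
  set H : ℝ → ℝ × (Fin n → ℝ) → ℝ := fun ε w => (splitBall n).indicator
    (fun v => signedPow 0 (w.1 + f v) - signedPow 0 w.1) (ε * w.1, w.2) with hH
  set H₀ : ℝ × (Fin n → ℝ) → ℝ := fun w =>
    (sqBall n 1).indicator (fun z => signedPow 0 (w.1 + f (0, z)) - signedPow 0 w.1) w.2 with hH₀
  set b : ℝ × (Fin n → ℝ) → ℝ := (Set.Icc (-C) C ×ˢ sqBall n 1).indicator fun _ => 2 with hb
  have hbI : Integrable b := by
    rw [hb, integrable_indicator_iff (measurableSet_Icc.prod hBm)]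
    refine (integrableOn_const_iff (by simp)).2 (Or.inr ?_)
    rw [Measure.volume_eq_prod, Measure.prod_prod]
    exact ENNReal.mul_lt_top (by simp) volume_sqBall_lt_top
  have hdiff : ∀ t y : ℝ, |y| ≤ C → C < |t| → signedPow 0 (t + y) = signedPow 0 t := by
    intro t y hy ht
    have := abs_le.1 hy
    rcases lt_abs.1 ht with h | h
    · rw [signedPow_zero_eq_sign, signedPow_zero_eq_sign, Real.sign_of_pos (by linarith),
        Real.sign_of_pos (by linarith [abs_nonneg y])]
    · rw [signedPow_zero_eq_sign, signedPow_zero_eq_sign, Real.sign_of_neg (by linarith),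
        Real.sign_of_neg (by linarith [abs_nonneg y])]
  have htwo : ∀ s t : ℝ, |signedPow 0 s - signedPow 0 t| ≤ 2 := fun s t =>
    (abs_sub _ _).trans (by linarith [hs1 s, hs1 t])
  have hHb : ∀ ε w, ‖H ε w‖ ≤ b w := by
    intro ε w
    by_cases hw : (ε * w.1, w.2) ∈ splitBall n
    · simp only [hH, hb, Set.indicator_of_mem hw, Real.norm_eq_abs]
      by_cases hC' : w.1 ∈ Set.Icc (-C) C
      · rw [Set.indicator_of_mem (Set.mk_mem_prod hC' (snd_mem_sqBall_of_mem_splitBall hw))]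
        exact htwo _ _
      · rw [hdiff _ _ (hC _ hw) (by
          by_contra! h; exact hC' (abs_le.1 h)), sub_self, abs_zero]
        exact Set.indicator_nonneg (fun _ _ => by norm_num) _
    · simp only [hH, Set.indicator_of_notMem hw, norm_zero]
      exact Set.indicator_nonneg (fun _ _ => by norm_num) _
  have hHm : ∀ ε, Measurable (H ε) := by
    intro ε
    have e : H ε = ((fun w : ℝ × (Fin n → ℝ) => (ε * w.1, w.2)) ⁻¹' splitBall n).indicator
        fun w => signedPow 0 (w.1 + f (ε * w.1, w.2)) - signedPow 0 w.1 := by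
      ext w; rfl
    rw [e]
    refine Measurable.indicator ?_ (hDm.preimage (by fun_prop))
    exact (hsm.comp (by fun_prop)).sub (hsm.comp (by fun_prop))
  have hHI : ∀ ε, Integrable (H ε) := fun ε =>
    hbI.mono' (hHm ε).aestronglyMeasurable (ae_of_all _ (hHb ε))
  -- the substitution
  have hrw : (fun ε : ℝ => ∫ w, H ε w) =ᶠ[𝓝[>] 0]
      fun ε : ℝ => ε⁻¹ * ∫ w in splitBall n, signedPow 0 (w.1 + ε * f w) := by
    filter_upwards [self_mem_nhdsWithin] with ε hε
    have hε : 0 < ε := hε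
    have hI : IntegrableOn (fun w => signedPow 0 (w.1 + ε * f w)) (splitBall n) :=
      IntegrableOn.of_bound volume_splitBall_lt_top
        (hsm.comp (by fun_prop)).aestronglyMeasurable 1 (ae_of_all _ fun w => hs1 _)
    have hI0 : IntegrableOn (fun w : ℝ × (Fin n → ℝ) => signedPow 0 w.1) (splitBall n) :=
      IntegrableOn.of_bound volume_splitBall_lt_top
        (hsm.comp (by fun_prop)).aestronglyMeasurable 1 (ae_of_all _ fun w => hs1 _)
    set G : ℝ × (Fin n → ℝ) → ℝ := (splitBall n).indicator
      fun w => signedPow 0 (w.1 + ε * f w) - signedPow 0 w.1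
    have hGI : Integrable G := (integrable_indicator_iff hDm).2 (hI.sub hI0)
    have hHG : ∀ s z, H ε (s, z) = G (ε * s, z) := by
      intro s z
      by_cases hw : (ε * s, z) ∈ splitBall n
      · simp only [hH, G, Set.indicator_of_mem hw]
        rw [← mul_add, signedPow_mul_of_pos 0 hε, signedPow_mul_of_pos 0 hε, Real.rpow_zero,
          one_mul, one_mul]
      · simp only [hH, G, Set.indicator_of_notMem hw]
    have hG : ∫ w, G w = ∫ w in splitBall n, signedPow 0 (w.1 + ε * f w) := by
      rw [integral_indicator hDm, integral_sub hI hI0, setIntegral_splitBall_signedPow_fst,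
        sub_zero]
    rw [← hG, Measure.volume_eq_prod, integral_prod_symm _ (hHI ε), integral_prod_symm _ hGI,
      ← integral_const_mul]
    congr 1
    ext z
    simp_rw [hHG]
    rw [Measure.integral_comp_mul_left (fun t => G (t, z)) ε, abs_of_pos (inv_pos.2 hε),
      smul_eq_mul]
  -- pointwise convergence away from a graph over the equator
  have hgraph : ∀ᵐ w : ℝ × (Fin n → ℝ), w.1 + f (0, w.2) ≠ 0 := by
    have hm : MeasurableSet {w : ℝ × (Fin n → ℝ) | w.1 + f (0, w.2) = 0} :=
      measurableSet_eq_fun (by fun_prop) (by fun_prop)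
    rw [ae_iff]
    simp only [ne_eq, not_not]
    rw [Measure.volume_eq_prod, Measure.prod_apply_symm hm, lintegral_eq_zero_iff
      (measurable_measure_prodMk_right hm)]
    refine ae_of_all _ fun z => ?_
    have : (fun s : ℝ => (s, z)) ⁻¹' {w : ℝ × (Fin n → ℝ) | w.1 + f (0, w.2) = 0} =
        {-f (0, z)} := by
      ext s
      simp [eq_neg_iff_add_eq_zero]
    simp [this]
  have hlim : Tendsto (fun ε : ℝ => ∫ w, H ε w) (𝓝[>] 0) (𝓝 (∫ w, H₀ w)) := by
    refine tendsto_integral_filter_of_dominated_convergence b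
      (Eventually.of_forall fun ε => (hHm ε).aestronglyMeasurable)
      (Eventually.of_forall fun ε => ae_of_all _ (hHb ε)) hbI ?_
    filter_upwards [hgraph] with w hw
    have hpath : Tendsto (fun ε : ℝ => (ε * w.1, w.2)) (𝓝[>] 0) (𝓝 (0, w.2)) := by
      have : Continuous fun ε : ℝ => (ε * w.1, w.2) := by fun_prop
      simpa using (this.tendsto 0).mono_left nhdsWithin_le_nhds
    by_cases hz : w.2 ∈ sqBall n 1
    · have hmem : ∀ᶠ ε : ℝ in 𝓝[>] 0, (ε * w.1, w.2) ∈ splitBall n := by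
        refine hpath.eventually (isOpen_splitBall.mem_nhds ?_)
        simpa [splitBall, sqBall] using hz
      simp only [hH₀, Set.indicator_of_mem hz]
      have h1 : Tendsto (fun ε : ℝ => signedPow 0 (w.1 + f (ε * w.1, w.2)) - signedPow 0 w.1)
          (𝓝[>] 0) (𝓝 (signedPow 0 (w.1 + f (0, w.2)) - signedPow 0 w.1)) :=
        ((hasDerivAt_signedPow 0 hw).continuousAt.tendsto.comp
          (((hf.tendsto _).comp hpath).const_add w.1)).sub_const _
      refine h1.congr' ?_
      filter_upwards [hmem] with ε hε
      simp only [hH, Set.indicator_of_mem hε]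
    · simp only [hH₀, Set.indicator_of_notMem hz]
      refine tendsto_const_nhds.congr fun ε => ?_
      have h' : (ε * w.1, w.2) ∉ splitBall n := fun h =>
        hz (snd_mem_sqBall_of_mem_splitBall (w := (ε * w.1, w.2)) h)
      simp only [hH, Set.indicator_of_notMem h']
  have hH₀I : Integrable H₀ := by
    have e : H₀ = ((fun w : ℝ × (Fin n → ℝ) => w.2) ⁻¹' sqBall n 1).indicator
        fun w => signedPow 0 (w.1 + f (0, w.2)) - signedPow 0 w.1 := by
      ext w; rfl
    have hm : Measurable H₀ := by
      rw [e]
      refine Measurable.indicator ?_ (hBm.preimage (by fun_prop))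
      exact (hsm.comp (by fun_prop)).sub (hsm.comp (by fun_prop))
    refine hbI.mono' hm.aestronglyMeasurable (ae_of_all _ fun w => ?_)
    by_cases hz : w.2 ∈ sqBall n 1
    · have hz' : ((0 : ℝ), w.2) ∈ splitBall n := by simpa [splitBall, sqBall] using hz
      simp only [hH₀, hb, Set.indicator_of_mem hz, Real.norm_eq_abs]
      by_cases hC' : w.1 ∈ Set.Icc (-C) C
      · rw [Set.indicator_of_mem (Set.mk_mem_prod hC' hz)]
        exact htwo _ _
      · rw [hdiff _ _ (hC _ hz') (by
          by_contra! h; exact hC' (abs_le.1 h)), sub_self, abs_zero]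
        exact Set.indicator_nonneg (fun _ _ => by norm_num) _
    · simp only [hH₀, Set.indicator_of_notMem hz, norm_zero]
      exact Set.indicator_nonneg (fun _ _ => by norm_num) _
  have hval : ∫ w, H₀ w = 2 * ∫ z in sqBall n 1, f (0, z) := by
    rw [Measure.volume_eq_prod, integral_prod_symm _ hH₀I, ← integral_const_mul,
      ← integral_indicator hBm]
    congr 1
    ext z
    by_cases hz : z ∈ sqBall n 1
    · simp only [hH₀, Set.indicator_of_mem hz]
      exact integral_signedPow_zero_add_sub _
    · simp only [hH₀, Set.indicator_of_notMem hz, integral_zero]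
  rw [← hval]
  exact hlim.congr' hrw

/-- The first-order expansion for all `q ≥ 0`, with the constants evaluated. The factor `κ`
depends on `n` and `q` only, and `A.trace` does not contain the coefficient `a` of the split
coordinate. -/
theorem exists_tendsto_integral_signedPow_splitForm (n : ℕ) {q : ℝ} (hq : 0 ≤ q) :
    ∃ κ : ℝ, 0 < κ ∧ ∀ (a : ℝ) (l : Fin n → ℝ) (A : Matrix (Fin n) (Fin n) ℝ) (c : ℝ),
      Tendsto (fun ε : ℝ => ε⁻¹ *
          ∫ w in splitBall n, signedPow q (w.1 + ε * (splitForm a l A w - c))) (𝓝[>] 0)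
        (𝓝 (κ * ((q * a + A.trace) / (q + n + 2) - c))) := by
  have hbound : ∀ (a : ℝ) (l : Fin n → ℝ) (A : Matrix (Fin n) (Fin n) ℝ) (c : ℝ),
      ∃ C, ∀ w ∈ splitBall n, |splitForm a l A w - c| ≤ C := by
    intro a l A c
    obtain ⟨C, hC⟩ := exists_splitForm_bound a l A
    exact ⟨C + |c|, fun w hw => (abs_sub _ _).trans (by linarith [hC w hw])⟩
  have hcont : ∀ (a : ℝ) (l : Fin n → ℝ) (A : Matrix (Fin n) (Fin n) ℝ) (c : ℝ),
      Continuous fun w => splitForm a l A w - c := fun a l A c =>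
    (continuous_splitForm a l A).sub continuous_const
  have hP := setIntegral_sqBall_dotProduct_mulVec n
  rcases hq.eq_or_lt with rfl | hq
  · refine ⟨2 * volume.real (sqBall n 1), by have := volume_sqBall_real_pos (n := n); positivity,
      fun a l A c => ?_⟩
    obtain ⟨C, hC⟩ := hbound a l A c
    convert tendsto_integral_signedPow_zero (hcont a l A c) hC using 2
    have hn : (n : ℝ) + 2 ≠ 0 := by positivity
    have e : ∀ z : Fin n → ℝ, splitForm a l A (0, z) = z ⬝ᵥ A *ᵥ z := by
      intro z; simp [splitForm]
    simp_rw [e]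
    rw [integral_sub (integrableOn_sqBall_of_continuous (by fun_prop))
      (integrableOn_sqBall_of_continuous continuous_const), setIntegral_const, smul_eq_mul]
    have h := hP A
    field_simp
    linear_combination -h
  · refine ⟨q * ∫ w in splitBall n, |w.1| ^ (q - 1),
      mul_pos hq (setIntegral_splitBall_abs_rpow_pos (by linarith)), fun a l A c => ?_⟩
    obtain ⟨C, hC⟩ := hbound a l A c
    obtain ⟨C', hC'⟩ := exists_splitForm_bound a l A
    convert tendsto_integral_signedPow_of_pos hq (hcont a l A c) hC using 2
    have hα : -1 < q - 1 := by linarith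
    have hn : q + n + 2 ≠ 0 := by positivity
    have h := setIntegral_splitBall_abs_rpow_mul_splitForm hα hP a l A
    simp_rw [mul_sub]
    rw [integral_sub (integrableOn_splitBall_abs_rpow_mul hα (continuous_splitForm a l A) hC')
      ((integrableOn_splitBall_abs_rpow hα).mul_const c), integral_mul_const]
    rw [show q - 1 + n + 3 = q + n + 2 by ring, sub_add_cancel] at h
    have h' : ∫ w in splitBall n, |w.1| ^ (q - 1) * splitForm a l A w =
        (∫ w in splitBall n, |w.1| ^ (q - 1)) * ((q * a + A.trace) / (q + n + 2)) := by
      rw [← mul_div_assoc, eq_div_iff hn, mul_comm, h]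
    rw [h']
    ring

end Limits

/-! ### Coordinate-free expansion, Taylor expansion and the normalized `p`-Laplacian -/

section Transfer

open Matrix

/-- Integration over the unit ball in the coordinates of an orthonormal basis, the first of them
split off. The closed ball is replaced by the open one, which differs from it by a null set. -/
theorem setIntegral_unitBall_eq_splitBall {n : ℕ}
    (b : OrthonormalBasis (Fin (n + 1)) ℝ (EuclideanSpace ℝ (Fin (n + 1))))
    (F : EuclideanSpace ℝ (Fin (n + 1)) → ℝ) :
    ∫ y in Metric.closedBall 0 1, F y =
      ∫ w in splitBall n, F (b.repr.symm (WithLp.toLp 2 (Fin.cons w.1 w.2))) := by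
  have hae : (Metric.closedBall (0 : EuclideanSpace ℝ (Fin (n + 1))) 1) =ᵐ[volume]
      Metric.ball (0 : EuclideanSpace ℝ (Fin (n + 1))) 1 :=
    (ae_eq_of_subset_of_measure_ge Metric.ball_subset_closedBall
      (Measure.addHaar_closedBall_eq_addHaar_ball volume _ _).le
      measurableSet_ball.nullMeasurableSet measure_closedBall_lt_top.ne).symm
  rw [setIntegral_congr_set hae]
  set e : (Fin (n + 1) → ℝ) ≃ᵐ EuclideanSpace ℝ (Fin (n + 1)) :=
    (MeasurableEquiv.toLp 2 (Fin (n + 1) → ℝ)).trans b.measurableEquiv.symm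
  have he : MeasurePreserving e volume volume :=
    b.measurePreserving_measurableEquiv.symm.comp
      (EuclideanSpace.volume_preserving_symm_measurableEquiv_toLp (Fin (n + 1))).symm
  have hev : ∀ z, e z = b.repr.symm (WithLp.toLp 2 z) := fun z => rfl
  rw [← he.setIntegral_preimage_emb e.measurableEmbedding]
  have hset : e ⁻¹' Metric.ball 0 1 = sqBall (n + 1) 1 := by
    ext z
    rw [Set.mem_preimage, mem_ball_zero_iff, hev, LinearIsometryEquiv.norm_map,
      ← sq_lt_one_iff₀ (norm_nonneg _), EuclideanSpace.real_norm_sq_eq]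
    simp [sqBall, dotProduct, pow_two]
  rw [hset, setIntegral_sqBall_succ (fun z => F (e z))]
  rfl

theorem inner_map_repr_symm {n : ℕ} (b : OrthonormalBasis (Fin n) ℝ (EuclideanSpace ℝ (Fin n)))
    (H : EuclideanSpace ℝ (Fin n) →L[ℝ] EuclideanSpace ℝ (Fin n)) (z : Fin n → ℝ) :
    inner ℝ (H (b.repr.symm (WithLp.toLp 2 z))) (b.repr.symm (WithLp.toLp 2 z)) =
      z ⬝ᵥ (Matrix.of fun i j => inner ℝ (b i) (H (b j))) *ᵥ z := by
  have hz : b.repr.symm (WithLp.toLp 2 z) = ∑ i, z i • b i := by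
    rw [← b.sum_repr_symm]
  rw [hz, real_inner_comm, map_sum, sum_inner]
  simp only [dotProduct, mulVec, Matrix.of_apply, map_smul, inner_sum, inner_smul_left,
    inner_smul_right, Finset.mul_sum]
  refine Finset.sum_congr rfl fun i _ => Finset.sum_congr rfl fun j _ => ?_
  simp only [conj_trivial]
  ring

/-- The coordinate-free first-order expansion of the subgradient, with the trace of `H` written in
the form in which it occurs in the divergence. It is reduced to the split coordinates by an
orthonormal basis that begins with `ξ / ‖ξ‖`. -/
theorem exists_tendsto_integral_signedPow_inner {N : ℕ} {q : ℝ} (hq : 0 ≤ q)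
    {ξ : EuclideanSpace ℝ (Fin N)} (hξ : ξ ≠ 0)
    (H : EuclideanSpace ℝ (Fin N) →L[ℝ] EuclideanSpace ℝ (Fin N)) :
    ∃ κ : ℝ, 0 < κ ∧ ∀ c : ℝ,
      Tendsto (fun ε : ℝ => ε⁻¹ * ∫ y in Metric.closedBall 0 1,
          signedPow q (inner ℝ ξ y + ε * (1 / 2 * inner ℝ (H y) y - c))) (𝓝[>] 0)
        (𝓝 (κ * (1 / 2 * ((∑ i, H (EuclideanSpace.single i 1) i +
          (q - 1) * (inner ℝ (H ξ) ξ / ‖ξ‖ ^ 2)) / (N + (q + 1))) - c))) := by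
  obtain _ | n := N
  · exact absurd (Subsingleton.elim ξ 0) hξ
  have hk : 0 < ‖ξ‖ := norm_pos_iff.2 hξ
  set k := ‖ξ‖ with hkdef
  obtain ⟨b, hb⟩ : ∃ b : OrthonormalBasis (Fin (n + 1)) ℝ (EuclideanSpace ℝ (Fin (n + 1))),
      b 0 = k⁻¹ • ξ := by
    have hv : Orthonormal ℝ (({0} : Set (Fin (n + 1))).domRestrict fun _ => k⁻¹ • ξ) := by
      constructor
      · intro i
        rw [Set.domRestrict_apply, norm_smul, norm_inv, hkdef, norm_norm, inv_mul_cancel₀ hk.ne']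
      · intro i j hij
        exact absurd (Subsingleton.elim i j) hij
    obtain ⟨b, hb⟩ := hv.exists_orthonormalBasis_extension_of_card_eq (by simp)
    exact ⟨b, hb 0 rfl⟩
  have hξb : ξ = k • b 0 := by rw [hb, smul_inv_smul₀ hk.ne']
  set M : Matrix (Fin (n + 1)) (Fin (n + 1)) ℝ :=
    Matrix.of fun i j => inner ℝ (b i) (H (b j)) with hM
  set A : Matrix (Fin (n + 1)) (Fin (n + 1)) ℝ := (2 * k)⁻¹ • M with hA
  obtain ⟨κ, hκ, hlim⟩ := exists_tendsto_integral_signedPow_splitForm n hq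
  refine ⟨k ^ q / k * κ, by positivity, fun c => ?_⟩
  have h := (hlim (A 0 0) (fun i => A 0 i.succ + A i.succ 0) (A.submatrix Fin.succ Fin.succ)
    (c / k)).const_mul (k ^ q)
  have hM00 : M 0 0 = inner ℝ (H ξ) ξ / k ^ 2 := by
    rw [hξb]
    simp only [hM, Matrix.of_apply, map_smul, inner_smul_left, inner_smul_right, conj_trivial]
    rw [real_inner_comm]
    field_simp
  have htr : M.trace = ∑ i, H (EuclideanSpace.single i 1) i := by
    have h1 := LinearMap.trace_eq_sum_inner (H : EuclideanSpace ℝ (Fin (n + 1)) →ₗ[ℝ] _) b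
    have h2 := LinearMap.trace_eq_sum_inner (H : EuclideanSpace ℝ (Fin (n + 1)) →ₗ[ℝ] _)
      (EuclideanSpace.basisFun (Fin (n + 1)) ℝ)
    rw [h1] at h2
    simpa [Matrix.trace, hM, EuclideanSpace.inner_single_left] using h2
  have hval : k ^ q * (κ * ((q * A 0 0 + (A.submatrix Fin.succ Fin.succ).trace) / (q + n + 2) -
      c / k)) = k ^ q / k * κ * (1 / 2 * ((∑ i, H (EuclideanSpace.single i 1) i +
          (q - 1) * (inner ℝ (H ξ) ξ / k ^ 2)) / ((n + 1 : ℕ) + (q + 1))) - c) := by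
    rw [← htr, ← hM00]
    have h1 := trace_eq_add_trace_succ A
    have h2 : A.trace = (2 * k)⁻¹ * M.trace := by rw [hA, Matrix.trace_smul, smul_eq_mul]
    have h3 : A 0 0 = (2 * k)⁻¹ * M 0 0 := rfl
    have h4 : (A.submatrix Fin.succ Fin.succ).trace = (2 * k)⁻¹ * (M.trace - M 0 0) := by
      rw [mul_sub, ← h2, ← h3, h1]; ring
    have h5 : q + n + 2 ≠ 0 := by positivity
    have h6 : ((n + 1 : ℕ) : ℝ) + (q + 1) = q + n + 2 := by push_cast; ring
    rw [h4, h3, h6]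
    field_simp
    ring
  rw [hval] at h
  refine h.congr fun ε => ?_
  rw [setIntegral_unitBall_eq_splitBall b, mul_left_comm, ← integral_const_mul (k ^ q)]
  congr 2
  ext w
  rw [← signedPow_mul_of_pos q hk, inner_map_repr_symm, ← hM]
  have h1 : inner ℝ ξ (b.repr.symm (WithLp.toLp 2 (Fin.cons w.1 w.2 : Fin (n + 1) → ℝ))) =
      k * w.1 := by
    rw [hξb, inner_smul_left, ← b.repr_apply_apply, LinearIsometryEquiv.apply_symm_apply]
    simp
  have h2 := dotProduct_mulVec_cons A w
  rw [hA, smul_mulVec, dotProduct_smul, smul_eq_mul, ← hA] at h2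
  rw [h1, ← h2]
  congr 1
  field_simp

end Transfer

theorem setIntegral_closedBall_eq_unitBall {N : ℕ} (x : EuclideanSpace ℝ (Fin N)) {ε : ℝ}
    (hε : 0 < ε) (f : EuclideanSpace ℝ (Fin N) → ℝ) :
    ∫ y in Metric.closedBall x ε, f y =
      ε ^ N * ∫ y in Metric.closedBall 0 1, f (x + ε • y) := by
  have h := Measure.setIntegral_comp_smul_of_pos volume (fun y => f (x + y))
    (Metric.closedBall (0 : EuclideanSpace ℝ (Fin N)) 1) hε
  rw [smul_unitClosedBall_of_nonneg hε.le, finrank_euclideanSpace_fin, smul_eq_mul] at h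
  rw [h, mul_inv_cancel_left₀ (by positivity)]
  have h1 := (measurePreserving_add_left volume x).setIntegral_preimage_emb
    (measurableEmbedding_addLeft x) f (Metric.closedBall x ε)
  rw [← h1]
  congr 2
  ext y
  simp

section Calculus

variable {N : ℕ} {Ω : Set (EuclideanSpace ℝ (Fin N))} {x : EuclideanSpace ℝ (Fin N)}
  {u : EuclideanSpace ℝ (Fin N) → ℝ}

theorem hasFDerivAt_gradient (hΩ : IsOpen Ω) (hx : x ∈ Ω) (hu : ContDiffOn ℝ 2 u Ω) :
    HasFDerivAt (gradient u) (fderiv ℝ (gradient u) x) x := by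
  have h1 : ContDiffAt ℝ 1 (fderiv ℝ u) x :=
    (hu.contDiffAt (hΩ.mem_nhds hx)).fderiv_right (by norm_num)
  have h2 : DifferentiableAt ℝ (fderiv ℝ u) x := h1.differentiableAt one_ne_zero
  have h3 : DifferentiableAt ℝ (gradient u) x :=
    (InnerProductSpace.toDual ℝ
      (EuclideanSpace ℝ (Fin N))).symm.toContinuousLinearEquiv.differentiableAt.comp x h2
  exact h3.hasFDerivAt

/-- The second-order Taylor expansion, with the Hessian as the derivative of the gradient. -/
theorem exists_taylor_bound (hΩ : IsOpen Ω) (hx : x ∈ Ω) (hu : ContDiffOn ℝ 2 u Ω) {η : ℝ}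
    (hη : 0 < η) : ∃ δ > 0, ∀ h : EuclideanSpace ℝ (Fin N), ‖h‖ < δ →
      |u (x + h) - (u x + inner ℝ (gradient u x) h +
        1 / 2 * inner ℝ (fderiv ℝ (gradient u) x h) h)| ≤ η * ‖h‖ ^ 2 := by
  set H := fderiv ℝ (gradient u) x
  have hG : HasFDerivAt (gradient u) H x := hasFDerivAt_gradient hΩ hx hu
  have h1 := (hasFDerivAt_iff_isLittleO_nhds_zero.1 hG).def hη
  have h2 : ∀ᶠ h : EuclideanSpace ℝ (Fin N) in 𝓝 0, x + h ∈ Ω := by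
    have : Tendsto (fun h => x + h) (𝓝 0) (𝓝 x) := by
      simpa using (continuous_const_add x).tendsto 0
    exact this (hΩ.mem_nhds hx)
  obtain ⟨δ, hδ, hball⟩ := Metric.eventually_nhds_iff_ball.1 (h1.and h2)
  refine ⟨δ, hδ, fun h hh => ?_⟩
  have hmem : ∀ t ∈ Set.Icc (0 : ℝ) 1, t • h ∈ Metric.ball (0 : EuclideanSpace ℝ (Fin N)) δ := by
    intro t ht
    rw [mem_ball_zero_iff, norm_smul, Real.norm_of_nonneg ht.1]
    nlinarith [ht.2, norm_nonneg h]
  have hd : ∀ t ∈ Set.Icc (0 : ℝ) 1, HasDerivWithinAt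
      (fun t : ℝ => u (x + t • h) - (u x + t * inner ℝ (gradient u x) h +
        1 / 2 * t ^ 2 * inner ℝ (H h) h))
      (inner ℝ (gradient u (x + t • h) - gradient u x - H (t • h)) h) (Set.Icc 0 1) t := by
    intro t ht
    have hdiff : DifferentiableAt ℝ u (x + t • h) :=
      (hu.contDiffAt (hΩ.mem_nhds (hball _ (hmem t ht)).2)).differentiableAt two_ne_zero
    have hp : HasDerivAt (fun t : ℝ => x + t • h) h t := by
      simpa using ((hasDerivAt_id t).smul_const h).const_add x
    have hu' := hdiff.hasFDerivAt.comp_hasDerivAt t hp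
    have e : fderiv ℝ u (x + t • h) h = inner ℝ (gradient u (x + t • h)) h := by
      simp [gradient]
    rw [e] at hu'
    have hl := (((hasDerivAt_id t).mul_const (inner ℝ (gradient u x) h)).const_add (u x)).add
      ((((hasDerivAt_id t).pow 2).const_mul (1 / 2)).mul_const (inner ℝ (H h) h))
    refine (hu'.sub hl).hasDerivWithinAt.congr_deriv ?_
    simp only [inner_sub_left, map_smul, inner_smul_left, id, conj_trivial]
    push_cast
    ring
  have hb : ∀ t ∈ Set.Ico (0 : ℝ) 1,
      ‖inner ℝ (gradient u (x + t • h) - gradient u x - H (t • h)) h‖ ≤ η * ‖h‖ ^ 2 := by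
    intro t ht
    have h3 := (hball _ (hmem t ⟨ht.1, ht.2.le⟩)).1
    rw [norm_smul, Real.norm_of_nonneg ht.1] at h3
    calc _ ≤ ‖gradient u (x + t • h) - gradient u x - H (t • h)‖ * ‖h‖ := norm_inner_le_norm _ _
      _ ≤ η * (1 * ‖h‖) * ‖h‖ := by
          refine mul_le_mul_of_nonneg_right (h3.trans ?_) (norm_nonneg _)
          gcongr
          exact ht.2.le
      _ = η * ‖h‖ ^ 2 := by ring
  have := norm_image_sub_le_of_norm_deriv_le_segment_01' hd hb
  simpa using this

/-- The normalized `p`-Laplacian is the Laplacian plus `p - 2` times the normalized `∞`-Laplacian.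
-/
theorem normalizedPLaplacian_eq (p : ℝ) (hΩ : IsOpen Ω) (hx : x ∈ Ω) (hu : ContDiffOn ℝ 2 u Ω)
    (hgrad : gradient u x ≠ 0) :
    normalizedPLaplacian p u x =
      ∑ i, fderiv ℝ (gradient u) x (EuclideanSpace.single i 1) i +
        (p - 2) * normalizedInftyLaplacian u x := by
  have hG := hasFDerivAt_gradient hΩ hx hu
  rw [normalizedPLaplacian, normalizedInftyLaplacian]
  set H := fderiv ℝ (gradient u) x
  set ξ := gradient u x with hξ
  have hk : 0 < ‖ξ‖ := norm_pos_iff.2 hgrad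
  have hpow : ∀ (r : ℝ) (v : EuclideanSpace ℝ (Fin N)), ‖v‖ ^ r = (‖v‖ ^ 2) ^ (r / 2) := by
    intro r v
    rw [← Real.rpow_natCast, ← Real.rpow_mul (norm_nonneg _)]
    congr 1
    push_cast
    ring
  have hF : HasFDerivAt (fun y => ‖gradient u y‖ ^ (p - 2) • gradient u y) _ x :=
    HasFDerivAt.smul (c := fun y => ‖gradient u y‖ ^ (p - 2)) (by
      simp_rw [hpow]
      exact hG.norm_sq.rpow_const (p := (p - 2) / 2) (Or.inl (by rw [← hξ]; positivity))) hG
  have hsum : ∑ i, inner ℝ ξ (H (EuclideanSpace.single i 1)) * ξ i = inner ℝ (H ξ) ξ := by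
    have : ξ = ∑ i, ξ i • EuclideanSpace.single i (1 : ℝ) := by
      simpa using ((EuclideanSpace.basisFun (Fin N) ℝ).sum_repr ξ).symm
    calc _ = inner ℝ ξ (H (∑ i, ξ i • EuclideanSpace.single i (1 : ℝ))) := by
          rw [map_sum, inner_sum]
          refine Finset.sum_congr rfl fun i _ => ?_
          rw [map_smul, inner_smul_right, mul_comm]
      _ = _ := by rw [← this, real_inner_comm]
  have hk2 : (‖ξ‖ ^ 2) ^ ((p - 2) / 2 - 1) = ‖ξ‖ ^ (p - 2) / ‖ξ‖ ^ 2 := by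
    rw [Real.rpow_sub_one (by positivity), ← hpow]
  rw [divergence, hF.fderiv, div_eq_iff (by positivity)]
  simp only [_root_.add_apply, _root_.smul_apply,
    ContinuousLinearMap.smulRight_apply, ContinuousLinearMap.comp_apply, innerSL_apply_apply,
    PiLp.add_apply, PiLp.smul_apply, smul_eq_mul, ← hξ, hk2, nsmul_eq_mul, Finset.sum_add_distrib,
    ← Finset.mul_sum]
  have e : ∑ i, (p - 2) / 2 * (‖ξ‖ ^ (p - 2) / ‖ξ‖ ^ 2) *
      ((2 : ℕ) * inner ℝ ξ (H (EuclideanSpace.single i 1))) * ξ i =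
      (p - 2) * (‖ξ‖ ^ (p - 2) / ‖ξ‖ ^ 2) * inner ℝ (H ξ) ξ := by
    rw [← hsum, Finset.mul_sum]
    refine Finset.sum_congr rfl fun i _ => ?_
    push_cast
    ring
  rw [e]
  ring

end Calculus

/-! ### Asymptotics of `p`-means -/

section Asymptotics

variable {N : ℕ} {Ω : Set (EuclideanSpace ℝ (Fin N))} {x : EuclideanSpace ℝ (Fin N)}
  {u : EuclideanSpace ℝ (Fin N) → ℝ}

/-- The Taylor expansion on the ball of radius `ε`, rescaled to the unit ball. -/
theorem eventually_taylor_unitBall (hΩ : IsOpen Ω) (hx : x ∈ Ω) (hu : ContDiffOn ℝ 2 u Ω) {η : ℝ}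
    (hη : 0 < η) : ∀ᶠ ε : ℝ in 𝓝[>] 0, ∀ v : EuclideanSpace ℝ (Fin N), ‖v‖ ≤ 1 →
      |u (x + ε • v) - (u x + ε * inner ℝ (gradient u x) v +
        ε ^ 2 * (1 / 2 * inner ℝ (fderiv ℝ (gradient u) x v) v))| ≤ η * ε ^ 2 := by
  obtain ⟨δ, hδ, h⟩ := exists_taylor_bound hΩ hx hu hη
  filter_upwards [Ioo_mem_nhdsGT hδ] with ε hε v hv
  have hn : ‖ε • v‖ = ε * ‖v‖ := by rw [norm_smul, Real.norm_of_nonneg hε.1.le]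
  have h1 := h (ε • v) (by rw [hn]; nlinarith [hε.1, hε.2, norm_nonneg v])
  have h2 : ‖ε • v‖ ^ 2 ≤ ε ^ 2 := by
    rw [hn]
    exact pow_le_pow_left₀ (mul_nonneg hε.1.le (norm_nonneg _))
      (mul_le_of_le_one_right hε.1.le hv) 2
  simp only [map_smul, inner_smul_left, inner_smul_right, conj_trivial] at h1
  refine le_trans (le_of_eq ?_) (h1.trans (mul_le_mul_of_nonneg_left h2 hη.le))
  congr 1
  ring

/-- The asymptotics of `p`-means for finite `p`. With `L` the claimed coefficient, the integral of
`signedPow (p - 1) (u - c)` at `c = u x + (L ± δ) * ε ^ 2` has the sign of `∓ δ` for small `ε`. -/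
theorem pMean_sub_isLittleO_of_ne_top {p : ℝ} (hp : 1 ≤ p) (hΩ : IsOpen Ω) (hx : x ∈ Ω)
    (hu : ContDiffOn ℝ 2 u Ω) (hgrad : gradient u x ≠ 0) :
    (fun ε : ℝ => pMean (ENNReal.ofReal p) ε u x -
        (u x + 1 / 2 * (normalizedPLaplacian p u x / ((N : ℝ) + p)) * ε ^ 2))
      =o[𝓝[>] (0 : ℝ)] fun ε : ℝ => ε ^ 2 := by
  have hq : 0 ≤ p - 1 := by linarith
  set H := fderiv ℝ (gradient u) x with hH
  set ξ := gradient u x with hξ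
  set L := 1 / 2 * (normalizedPLaplacian p u x / ((N : ℝ) + p)) with hL
  obtain ⟨κ, hκ, hlim⟩ := exists_tendsto_integral_signedPow_inner hq hgrad H
  have hlim' : ∀ c : ℝ, Tendsto (fun ε : ℝ => ε⁻¹ * ∫ y in Metric.closedBall 0 1,
      signedPow (p - 1) (inner ℝ ξ y + ε * (1 / 2 * inner ℝ (H y) y - c))) (𝓝[>] 0)
        (𝓝 (κ * (L - c))) := by
    intro c
    have := hlim c
    rwa [sub_add_cancel, show p - 1 - 1 = p - 2 by ring, ← normalizedInftyLaplacian,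
      ← normalizedPLaplacian_eq p hΩ hx hu hgrad] at this
  refine isLittleO_iff.2 fun δ hδ => ?_
  have hup := (hlim' (L + δ / 2)).eventually_lt_const
    (mul_neg_of_pos_of_neg hκ (by linarith : L - (L + δ / 2) < 0))
  have hlo := (hlim' (L - δ / 2)).eventually_const_lt
    (mul_pos hκ (by linarith : 0 < L - (L - δ / 2)))
  filter_upwards [hup, hlo, self_mem_nhdsWithin,
    nhdsWithin_le_nhds (eventually_closedBall_subset (hΩ.mem_nhds hx)),
    eventually_taylor_unitBall hΩ hx hu (half_pos hδ)] with ε hup hlo hε hsub htay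
  have hε : 0 < ε := hε
  have hup : ∫ y in Metric.closedBall 0 1,
      signedPow (p - 1) (inner ℝ ξ y + ε * (1 / 2 * inner ℝ (H y) y - (L + δ / 2))) < 0 := by
    by_contra! h
    exact absurd hup (not_lt.2 (by positivity))
  have hlo : 0 < ∫ y in Metric.closedBall 0 1,
      signedPow (p - 1) (inner ℝ ξ y + ε * (1 / 2 * inner ℝ (H y) y - (L - δ / 2))) :=
    pos_of_mul_pos_right hlo (by positivity)
  have hcont : ContinuousOn u (Metric.closedBall x ε) := hu.continuousOn.mono hsub
  have hcont' : ContinuousOn (fun v => u (x + ε • v)) (Metric.closedBall 0 1) := by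
    refine hcont.comp (by fun_prop) fun v hv => ?_
    rw [mem_closedBall_zero_iff] at hv
    rw [mem_closedBall_iff_norm, add_sub_cancel_left, norm_smul, Real.norm_of_nonneg hε.le]
    exact mul_le_of_le_one_right hε.le hv
  have hI : ∀ c : ℝ, IntegrableOn (fun v => signedPow (p - 1) (u (x + ε • v) - c))
      (Metric.closedBall 0 1) := fun c => integrableOn_signedPow_sub hq hcont' c
  have hI' : ∀ c : ℝ, IntegrableOn (fun y => ε ^ (p - 1) *
      signedPow (p - 1) (inner ℝ ξ y + ε * (1 / 2 * inner ℝ (H y) y - c)))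
      (Metric.closedBall 0 1) := by
    intro c
    have hc : Continuous fun y => inner ℝ ξ y + ε * (1 / 2 * inner ℝ (H y) y - c) := by fun_prop
    have := integrableOn_signedPow_sub hq (x := (0 : EuclideanSpace ℝ (Fin N))) (ε := 1)
      hc.continuousOn 0
    simp only [sub_zero] at this
    exact this.const_mul _
  have hmean := isPMean_pMean (p := ENNReal.ofReal p) (by simpa using hp) hε hcont
  have h1 : pMean (ENNReal.ofReal p) ε u x ≤ u x + (L + δ) * ε ^ 2 := by
    refine hmean.le_of_integral_neg hp hcont ?_
    rw [setIntegral_closedBall_eq_unitBall x hε]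
    refine mul_neg_of_pos_of_neg (by positivity) (lt_of_le_of_lt
      (setIntegral_mono_on (hI _) (hI' (L + δ / 2)) measurableSet_closedBall fun y hy => ?_) ?_)
    · rw [← signedPow_mul_of_pos _ hε]
      refine monotone_signedPow hq ?_
      have := (abs_le.1 (htay y (mem_closedBall_zero_iff.1 hy))).2
      linarith
    · rw [integral_const_mul]
      exact mul_neg_of_pos_of_neg (by positivity) hup
  have h2 : u x + (L - δ) * ε ^ 2 ≤ pMean (ENNReal.ofReal p) ε u x := by
    refine hmean.ge_of_integral_pos hp hcont ?_
    rw [setIntegral_closedBall_eq_unitBall x hε]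
    refine mul_pos (by positivity) (lt_of_lt_of_le ?_
      (setIntegral_mono_on (hI' (L - δ / 2)) (hI _) measurableSet_closedBall fun y hy => ?_))
    · rw [integral_const_mul]
      exact mul_pos (by positivity) hlo
    · rw [← signedPow_mul_of_pos _ hε]
      refine monotone_signedPow hq ?_
      have := (abs_le.1 (htay y (mem_closedBall_zero_iff.1 hy))).1
      linarith
  rw [Real.norm_eq_abs, Real.norm_of_nonneg (sq_nonneg ε), abs_le]
  constructor <;> linarith

/-- On the unit ball the linear part loses a multiple of the squared distance from its maximum
point `e`, which dominates the first-order variation of the quadratic part up to an error of order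
`ε`. -/
theorem eventually_inner_add_abs_quadratic_le {ξ : EuclideanSpace ℝ (Fin N)} (hξ : ξ ≠ 0)
    (H : EuclideanSpace ℝ (Fin N) →L[ℝ] EuclideanSpace ℝ (Fin N)) {η : ℝ} (hη : 0 < η) :
    ∀ᶠ ε : ℝ in 𝓝[>] 0, ∀ v : EuclideanSpace ℝ (Fin N), ‖v‖ ≤ 1 →
      ε * inner ℝ ξ v + ε ^ 2 * |1 / 2 * inner ℝ (H v) v -
        1 / 2 * (inner ℝ (H ξ) ξ / ‖ξ‖ ^ 2)| ≤ ε * ‖ξ‖ + η * ε ^ 2 := by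
  have hk : 0 < ‖ξ‖ := norm_pos_iff.2 hξ
  set k := ‖ξ‖
  obtain ⟨e, he, hξe⟩ : ∃ e : EuclideanSpace ℝ (Fin N), ‖e‖ = 1 ∧ ξ = k • e :=
    ⟨k⁻¹ • ξ, by rw [norm_smul, norm_inv, norm_norm, inv_mul_cancel₀ hk.ne'],
      by rw [smul_inv_smul₀ hk.ne']⟩
  have hHe : inner ℝ (H ξ) ξ / k ^ 2 = inner ℝ (H e) e := by
    rw [hξe, map_smul, inner_smul_left, inner_smul_right, conj_trivial]
    field_simp
  have hsmall : ∀ᶠ ε : ℝ in 𝓝[>] 0, ε * (‖H‖ ^ 2 / (2 * k)) < η := by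
    have : Tendsto (fun ε : ℝ => ε * (‖H‖ ^ 2 / (2 * k))) (𝓝[>] 0) (𝓝 0) := by
      have h : Continuous fun ε : ℝ => ε * (‖H‖ ^ 2 / (2 * k)) := by fun_prop
      simpa using (h.tendsto 0).mono_left nhdsWithin_le_nhds
    exact this.eventually_lt_const hη
  filter_upwards [hsmall, self_mem_nhdsWithin] with ε hε hε0 v hv
  have hε0 : 0 < ε := hε0
  set d := ‖v - e‖ with hd
  have hd0 : 0 ≤ d := norm_nonneg _
  have hlin : inner ℝ ξ v ≤ k - k * d ^ 2 / 2 := by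
    have h1 : d ^ 2 = ‖v‖ ^ 2 - 2 * inner ℝ v e + 1 := by
      rw [hd, norm_sub_sq_real, he]; ring
    have h2 : ‖v‖ ^ 2 ≤ 1 := pow_le_one₀ (norm_nonneg _) hv
    have h3 : inner ℝ ξ v = k * inner ℝ v e := by
      rw [hξe, inner_smul_left, conj_trivial, real_inner_comm]
    rw [h3]
    nlinarith
  have hquad : |1 / 2 * inner ℝ (H v) v - 1 / 2 * inner ℝ (H e) e| ≤ ‖H‖ * d := by
    have h1 : inner ℝ (H v) v - inner ℝ (H e) e =
        inner ℝ (H (v - e)) v + inner ℝ (H e) (v - e) := by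
      rw [map_sub, inner_sub_left, inner_sub_right]; ring
    have h2 : |inner ℝ (H (v - e)) v| ≤ ‖H‖ * d := by
      calc _ ≤ ‖H (v - e)‖ * ‖v‖ := abs_real_inner_le_norm _ _
        _ ≤ ‖H‖ * ‖v - e‖ * 1 := by gcongr; exact H.le_opNorm _
        _ = _ := mul_one _
    have h3 : |inner ℝ (H e) (v - e)| ≤ ‖H‖ * d := by
      calc _ ≤ ‖H e‖ * ‖v - e‖ := abs_real_inner_le_norm _ _
        _ ≤ ‖H‖ * ‖e‖ * ‖v - e‖ := by gcongr; exact H.le_opNorm _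
        _ = _ := by rw [he, mul_one]
    rw [← mul_sub, h1, abs_mul, abs_of_pos (by norm_num : (0 : ℝ) < 1 / 2)]
    linarith [abs_add_le (inner ℝ (H (v - e)) v) (inner ℝ (H e) (v - e))]
  have hyoung : ε * (‖H‖ * d) ≤ k * d ^ 2 / 2 + ε * (ε * (‖H‖ ^ 2 / (2 * k))) := by
    have h1 : k * d ^ 2 / 2 + ε * (ε * (‖H‖ ^ 2 / (2 * k))) - ε * (‖H‖ * d) =
        (k * d - ε * ‖H‖) ^ 2 / (2 * k) := by
      field_simp; ring
    have h2 : 0 ≤ (k * d - ε * ‖H‖) ^ 2 / (2 * k) := by positivity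
    linarith
  rw [hHe]
  calc ε * inner ℝ ξ v + ε ^ 2 * |1 / 2 * inner ℝ (H v) v - 1 / 2 * inner ℝ (H e) e|
      ≤ ε * (k - k * d ^ 2 / 2) + ε ^ 2 * (‖H‖ * d) := by gcongr
    _ = ε * k + ε * (ε * (‖H‖ * d) - k * d ^ 2 / 2) := by ring
    _ ≤ ε * k + ε * (ε * η) := by
        have : ε * (‖H‖ * d) - k * d ^ 2 / 2 ≤ ε * η := by
          have := mul_le_mul_of_nonneg_left hε.le hε0.le
          linarith
        gcongr
    _ = _ := by ring

/-- The asymptotics of `∞`-means: to order `ε ^ 2` the maximum and the minimum over the ball are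
attained in the directions `± ∇u`, where the quadratic parts agree and the linear parts cancel. -/
theorem pMean_top_sub_isLittleO (hΩ : IsOpen Ω) (hx : x ∈ Ω)
    (hu : ContDiffOn ℝ 2 u Ω) (hgrad : gradient u x ≠ 0) :
    (fun ε : ℝ => pMean ∞ ε u x - (u x + 1 / 2 * normalizedInftyLaplacian u x * ε ^ 2))
      =o[𝓝[>] (0 : ℝ)] fun ε : ℝ => ε ^ 2 := by
  rw [normalizedInftyLaplacian]
  set H := fderiv ℝ (gradient u) x with hH
  set ξ := gradient u x with hξ
  set a := inner ℝ (H ξ) ξ / ‖ξ‖ ^ 2 with ha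
  have hk : 0 < ‖ξ‖ := norm_pos_iff.2 hgrad
  refine isLittleO_iff.2 fun δ hδ => ?_
  filter_upwards [self_mem_nhdsWithin,
    nhdsWithin_le_nhds (eventually_closedBall_subset (hΩ.mem_nhds hx)),
    eventually_taylor_unitBall hΩ hx hu (half_pos hδ),
    eventually_inner_add_abs_quadratic_le hgrad H (half_pos hδ)] with ε hε hsub htay hquad
  have hε : 0 < ε := hε
  rw [← hξ, ← hH] at htay
  have hcont : ContinuousOn u (Metric.closedBall x ε) := hu.continuousOn.mono hsub
  have hne : (Metric.closedBall x ε).Nonempty := Metric.nonempty_closedBall.2 hε.le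
  obtain ⟨y, hy, hmax⟩ := (isCompact_closedBall x ε).exists_isMaxOn hne hcont
  obtain ⟨z, hz, hmin⟩ := (isCompact_closedBall x ε).exists_isMinOn hne hcont
  rw [(isPMean_pMean le_top hε hcont).eq_midpoint hε hcont hy hz hmax hmin]
  have hscale : ∀ w ∈ Metric.closedBall x ε, ∃ v : EuclideanSpace ℝ (Fin N), ‖v‖ ≤ 1 ∧
      w = x + ε • v := by
    intro w hw
    refine ⟨ε⁻¹ • (w - x), ?_, by rw [smul_inv_smul₀ hε.ne', add_sub_cancel]⟩
    rw [norm_smul, norm_inv, Real.norm_of_nonneg hε.le, inv_mul_le_iff₀ hε, mul_one]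
    exact mem_closedBall_iff_norm.1 hw
  have hmem : ∀ v : EuclideanSpace ℝ (Fin N), ‖v‖ ≤ 1 → x + ε • v ∈ Metric.closedBall x ε := by
    intro v hv
    rw [mem_closedBall_iff_norm, add_sub_cancel_left, norm_smul, Real.norm_of_nonneg hε.le]
    exact mul_le_of_le_one_right hε.le hv
  -- the unit vector in the direction of the gradient
  set e := ‖ξ‖⁻¹ • ξ with he
  have hen : ‖e‖ ≤ 1 := by
    rw [he, norm_smul, norm_inv, norm_norm, inv_mul_cancel₀ hk.ne']
  have hξe : inner ℝ ξ e = ‖ξ‖ := by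
    rw [he, inner_smul_right, real_inner_self_eq_norm_sq]
    field_simp
  have hHe : inner ℝ (H e) e = a := by
    rw [he, map_smul, inner_smul_left, inner_smul_right, conj_trivial, ha]
    field_simp
  have hy1 : u x + ε * ‖ξ‖ + ε ^ 2 * (1 / 2 * a) - δ / 2 * ε ^ 2 ≤ u y := by
    have h1 := (abs_le.1 (htay e hen)).1
    have h2 : u (x + ε • e) ≤ u y := hmax (hmem e hen)
    rw [hξe, hHe] at h1
    linarith
  have hz1 : u z ≤ u x - ε * ‖ξ‖ + ε ^ 2 * (1 / 2 * a) + δ / 2 * ε ^ 2 := by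
    have hen' : ‖-e‖ ≤ 1 := by rwa [norm_neg]
    have h1 := (abs_le.1 (htay (-e) hen')).2
    have h2 : u z ≤ u (x + ε • -e) := hmin (hmem (-e) hen')
    rw [map_neg, inner_neg_neg, inner_neg_right, hξe, hHe] at h1
    linarith
  have hy2 : u y ≤ u x + ε * ‖ξ‖ + ε ^ 2 * (1 / 2 * a) + δ * ε ^ 2 := by
    obtain ⟨v, hv, rfl⟩ := hscale y hy
    have h1 := (abs_le.1 (htay v hv)).2
    have h2 := hquad v hv
    have h3 := mul_le_mul_of_nonneg_left (le_abs_self (1 / 2 * inner ℝ (H v) v - 1 / 2 * a))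
      (sq_nonneg ε)
    linarith
  have hz2 : u x - ε * ‖ξ‖ + ε ^ 2 * (1 / 2 * a) - δ * ε ^ 2 ≤ u z := by
    obtain ⟨v, hv, rfl⟩ := hscale z hz
    have h1 := (abs_le.1 (htay v hv)).1
    have h2 := hquad (-v) (by rwa [norm_neg])
    rw [map_neg, inner_neg_neg, inner_neg_right] at h2
    have h3 := mul_le_mul_of_nonneg_left (neg_abs_le (1 / 2 * inner ℝ (H v) v - 1 / 2 * a))
      (sq_nonneg ε)
    linarith
  have hpos : 0 ≤ δ * ε ^ 2 := by positivity
  rw [Real.norm_eq_abs, Real.norm_of_nonneg (sq_nonneg ε), abs_le]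
  constructor <;> linarith

end Asymptotics

theorem theorem3p2 {N : ℕ} (p : ℝ≥0∞) (hp : 1 ≤ p)
    (Ω : Set (EuclideanSpace ℝ (Fin N))) (hΩ : IsOpen Ω)
    (x : EuclideanSpace ℝ (Fin N)) (hx : x ∈ Ω)
    (u : EuclideanSpace ℝ (Fin N) → ℝ) (hu : ContDiffOn ℝ 2 u Ω)
    (hgrad : gradient u x ≠ 0) :
    (∀ ε : ℝ, 0 < ε → Metric.closedBall x ε ⊆ Ω → ∃! m : ℝ, IsPMean p ε u x m) ∧
    (p ≠ ∞ →
      (fun ε : ℝ => pMean p ε u x -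
          (u x + 1 / 2 * (normalizedPLaplacian p.toReal u x / ((N : ℝ) + p.toReal)) * ε ^ 2))
        =o[𝓝[>] (0 : ℝ)] fun ε : ℝ => ε ^ 2) ∧
    (p = ∞ →
      (fun ε : ℝ => pMean p ε u x -
          (u x + 1 / 2 * normalizedInftyLaplacian u x * ε ^ 2))
        =o[𝓝[>] (0 : ℝ)] fun ε : ℝ => ε ^ 2) := by
  refine ⟨fun ε hε hsub => existsUnique_isPMean hp hε (hu.continuousOn.mono hsub),
    fun hpt => ?_, fun hpt => ?_⟩
  · have h := pMean_sub_isLittleO_of_ne_top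
      (by simpa using ENNReal.toReal_mono hpt hp : 1 ≤ p.toReal) hΩ hx hu hgrad
    rwa [ENNReal.ofReal_toReal hpt] at h
  · rw [hpt]
    exact pMean_top_sub_isLittleO hΩ hx hu hgrad
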